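/- Let $Q=\overline{U}_{\mathrm i}\,s\ell(2)$ be the restricted quantum group at $\mathfrak q=\mathrm i$, that is, the unital associative $\mathbb C$-algebra with generators $E,F,K^{\pm1}$ and relations $$KK^{-1}=K^{-1}K=1,\quad KEK^{-1}=-E,\quad KFK^{-1}=-F,\quad EF-FE=\frac{K-K^{-1}}{2\mathrm i},\quad E^2=F^2=0,\quad K^4=1,$$ with the Hopf algebra structure $$\Delta(E)=1\otimes E+E\otimes K,\quad \Delta(F)=K^{-1}\otimes F+F\otimes 1,\quad \Delta(K)=K\otimes K,$$ $$\epsilon(E)=\epsilon(F)=0,\quad \epsilon(K)=1,\quad S(E)=-EK^{-1},\quad S(F)=-KF,\quad S(K)=K^{-1}.$$ Let $\mathbf{Rep}\,Q$ be the monoidal category of finite-dimensional $Q$-modules, where $Q$ acts on $U\otimes V$ through $\Delta$ and on the tensor unit $\mathbb C$ through $\epsilon$, and the associativity and unit isomorphisms are those of vector spaces. Then: 1. $\dim_{\mathbb C}Q=16$. 2. $\mathbf{Rep}\,Q$ is not braidable: this monoidal category admits no braiding. 3. Equivalently, $Q$ has no universal R-matrix: there is no invertible $R\in Q\otimes Q$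 with $R\,\Delta(a)=\Delta^{\mathrm{op}}(a)\,R$ for all $a\in Q$, $(\Delta\otimes\mathrm{id})(R)=R_{13}R_{23}$ and $(\mathrm{id}\otimes\Delta)(R)=R_{13}R_{12}$. 4. Nevertheless, $U\otimes V\cong V\otimes U$ as $Q$-modules for all finite-dimensional $Q$-modules $U$ and $V$. -/

import Mathlib

open CategoryTheory MonoidalCategory
open scoped TensorProduct

noncomputable section

/-! ### The restricted quantum group of `sl(2)` at `q = i` -/

namespace RestrictedQuantumGroup

/-- The algebra generators `E`, `F`, `K`, `K⁻¹`. -/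
inductive Gen : Type
  | E | F | K | Kinv

/-- The free algebra on the generators. -/
abbrev Free : Type := FreeAlgebra ℂ Gen

/-- The image of a generator in the free algebra. -/
abbrev gen (g : Gen) : Free := FreeAlgebra.ι ℂ g

/-- The defining relations of the restricted quantum group at `q = i`
(so `q ^ 2 = q ^ (-2) = -1` and `q - q⁻¹ = 2 i`). -/
inductive Rel : Free → Free → Prop
  | K_Kinv : Rel (gen .K * gen .Kinv) 1
  | Kinv_K : Rel (gen .Kinv * gen .K) 1
  | K_E : Rel (gen .K * gen .E * gen .Kinv) (-gen .E)
  | K_F : Rel (gen .K * gen .F * gen .Kinv) (-gen .F)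
  | E_F : Rel (gen .E * gen .F - gen .F * gen .E)
      ((2 * Complex.I)⁻¹ • (gen .K - gen .Kinv))
  | E_sq : Rel (gen .E ^ 2) 0
  | F_sq : Rel (gen .F ^ 2) 0
  | K_four : Rel (gen .K ^ 4) 1

/-- The restricted quantum group `Q` of `sl(2)` at `q = i`, as a complex algebra. -/
def Q : Type := RingQuot Rel

instance : Ring Q := inferInstanceAs (Ring (RingQuot Rel))

instance : Algebra ℂ Q := inferInstanceAs (Algebra ℂ (RingQuot Rel))

namespace Q

/-- The quotient map from the free algebra. -/
def mk : Free →ₐ[ℂ] Q := RingQuot.mkAlgHom ℂ Rel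

/-- The generator `E` of `Q`. -/
def E : Q := mk (gen .E)
/-- The generator `F` of `Q`. -/
def F : Q := mk (gen .F)
/-- The generator `K` of `Q`. -/
def K : Q := mk (gen .K)
/-- The generator `K⁻¹` of `Q`. -/
def Kinv : Q := mk (gen .Kinv)

lemma mk_rel {x y : Free} (h : Rel x y) : mk x = mk y := RingQuot.mkAlgHom_rel ℂ h

lemma K_mul_Kinv : K * Kinv = 1 := by simpa [K, Kinv] using mk_rel Rel.K_Kinv
lemma Kinv_mul_K : Kinv * K = 1 := by simpa [K, Kinv] using mk_rel Rel.Kinv_K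
lemma K_E_Kinv : K * E * Kinv = -E := by simpa [K, Kinv, E] using mk_rel Rel.K_E
lemma K_F_Kinv : K * F * Kinv = -F := by simpa [K, Kinv, F] using mk_rel Rel.K_F
lemma E_F_sub : E * F - F * E = (2 * Complex.I)⁻¹ • (K - Kinv) := by
  have h := mk_rel Rel.E_F
  simp only [map_sub, map_mul, map_smul] at h
  exact h
lemma E_mul_E : E * E = 0 := by simpa [E, sq] using mk_rel Rel.E_sq
lemma F_mul_F : F * F = 0 := by simpa [F, sq] using mk_rel Rel.F_sq
lemma K_pow_four : K ^ 4 = 1 := by simpa [K] using mk_rel Rel.K_four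

lemma K_mul_E : K * E = -(E * K) := by
  have h := congrArg (· * K) K_E_Kinv
  simpa [mul_assoc, Kinv_mul_K] using h
lemma K_mul_F : K * F = -(F * K) := by
  have h := congrArg (· * K) K_F_Kinv
  simpa [mul_assoc, Kinv_mul_K] using h
lemma Kinv_mul_E : Kinv * E = -(E * Kinv) := by
  have h := congrArg (Kinv * ·) K_E_Kinv
  simp only [← mul_assoc, Kinv_mul_K, one_mul] at h
  rw [h]; simp
lemma Kinv_mul_F : Kinv * F = -(F * Kinv) := by
  have h := congrArg (Kinv * ·) K_F_Kinv
  simp only [← mul_assoc, Kinv_mul_K, one_mul] at h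
  rw [h]; simp
lemma F_mul_E : F * E = E * F - (2 * Complex.I)⁻¹ • (K - Kinv) := by
  rw [← E_F_sub]; abel
lemma Kinv_pow_four : Kinv ^ 4 = 1 := by
  have h : (Commute K Kinv) := by rw [Commute, SemiconjBy, K_mul_Kinv, Kinv_mul_K]
  have := h.mul_pow 4
  rwa [K_mul_Kinv, K_pow_four, one_pow, one_mul, eq_comm] at this

/-- The universal property of `Q`: algebra maps out of `Q` are given by the images of the
generators, subject to the defining relations. -/
def lift {A : Type*} [Ring A] [Algebra ℂ A] (f : Gen → A)
    (h : ∀ ⦃x y⦄, Rel x y → FreeAlgebra.lift ℂ f x = FreeAlgebra.lift ℂ f y) : Q →ₐ[ℂ] A :=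
  RingQuot.liftAlgHom ℂ ⟨FreeAlgebra.lift ℂ f, h⟩

lemma lift_mk {A : Type*} [Ring A] [Algebra ℂ A] (f : Gen → A)
    (h : ∀ ⦃x y⦄, Rel x y → FreeAlgebra.lift ℂ f x = FreeAlgebra.lift ℂ f y) (g : Gen) :
    lift f h (mk (gen g)) = f g := by
  unfold lift mk
  erw [RingQuot.liftAlgHom_mkAlgHom_apply]
  simp

lemma hom_ext {A : Type*} [Semiring A] [Algebra ℂ A] {f g : Q →ₐ[ℂ] A}
    (hE : f E = g E) (hF : f F = g F) (hK : f K = g K) (hKinv : f Kinv = g Kinv) : f = g := by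
  have : f.comp mk = g.comp mk := by
    apply FreeAlgebra.hom_ext
    funext x
    cases x
    · exact hE
    · exact hF
    · exact hK
    · exact hKinv
  exact RingQuot.ringQuot_ext' (S := ℂ) f g this

/-- The values of the comultiplication on the generators. -/
def comulGen : Gen → Q ⊗[ℂ] Q
  | .E => 1 ⊗ₜ E + E ⊗ₜ K
  | .F => Kinv ⊗ₜ F + F ⊗ₜ 1
  | .K => K ⊗ₜ K
  | .Kinv => Kinv ⊗ₜ Kinv

lemma comulGen_rel ⦃x y : Free⦄ (h : Rel x y) :
    FreeAlgebra.lift ℂ comulGen x = FreeAlgebra.lift ℂ comulGen y := by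
  induction h with
  | K_Kinv => simp [comulGen, K_mul_Kinv, Algebra.TensorProduct.one_def]
  | Kinv_K => simp [comulGen, Kinv_mul_K, Algebra.TensorProduct.one_def]
  | K_E =>
    simp [comulGen, mul_add, add_mul, K_mul_Kinv, K_E_Kinv, TensorProduct.tmul_neg,
      TensorProduct.neg_tmul, mul_assoc K K Kinv]
    abel
  | K_F =>
    simp [comulGen, mul_add, add_mul, K_mul_Kinv, K_F_Kinv, TensorProduct.tmul_neg,
      TensorProduct.neg_tmul]
    abel
  | E_F =>
    simp only [comulGen, map_sub, map_mul, map_smul, FreeAlgebra.lift_ι_apply, mul_add, add_mul,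
      Algebra.TensorProduct.tmul_mul_tmul, one_mul, mul_one, K_mul_F, Kinv_mul_E, F_mul_E,
      TensorProduct.tmul_neg, TensorProduct.neg_tmul, TensorProduct.tmul_sub,
      TensorProduct.sub_tmul, TensorProduct.tmul_smul, TensorProduct.smul_tmul', smul_sub]
    simp only [← TensorProduct.smul_tmul']
    abel
  | E_sq => simp [comulGen, sq, mul_add, add_mul, E_mul_E, K_mul_E, TensorProduct.tmul_neg]
  | F_sq => simp [comulGen, sq, mul_add, add_mul, F_mul_F, Kinv_mul_F, TensorProduct.neg_tmul]
  | K_four => simp [comulGen, Algebra.TensorProduct.tmul_pow, K_pow_four,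
      Algebra.TensorProduct.one_def]

/-- The comultiplication of `Q`. -/
def comulHom : Q →ₐ[ℂ] Q ⊗[ℂ] Q := lift comulGen comulGen_rel

@[simp] lemma comulHom_E : comulHom E = 1 ⊗ₜ E + E ⊗ₜ K := lift_mk _ comulGen_rel _
@[simp] lemma comulHom_F : comulHom F = Kinv ⊗ₜ F + F ⊗ₜ 1 := lift_mk _ comulGen_rel _
@[simp] lemma comulHom_K : comulHom K = K ⊗ₜ K := lift_mk _ comulGen_rel _
@[simp] lemma comulHom_Kinv : comulHom Kinv = Kinv ⊗ₜ Kinv := lift_mk _ comulGen_rel _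

/-- The values of the counit on the generators. -/
def counitGen : Gen → ℂ
  | .E => 0
  | .F => 0
  | .K => 1
  | .Kinv => 1

lemma counitGen_rel ⦃x y : Free⦄ (h : Rel x y) :
    FreeAlgebra.lift ℂ counitGen x = FreeAlgebra.lift ℂ counitGen y := by
  induction h <;> simp [counitGen]

/-- The counit of `Q`. -/
def counitHom : Q →ₐ[ℂ] ℂ := lift counitGen counitGen_rel

@[simp] lemma counitHom_E : counitHom E = 0 := lift_mk _ counitGen_rel _
@[simp] lemma counitHom_F : counitHom F = 0 := lift_mk _ counitGen_rel _
@[simp] lemma counitHom_K : counitHom K = 1 := lift_mk _ counitGen_rel _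
@[simp] lemma counitHom_Kinv : counitHom Kinv = 1 := lift_mk _ counitGen_rel _

instance : Bialgebra ℂ Q :=
  Bialgebra.ofAlgHom comulHom counitHom
    (by
      apply hom_ext <;>
        simp [TensorProduct.add_tmul, TensorProduct.tmul_add, Algebra.TensorProduct.one_def,
          add_assoc])
    (by apply hom_ext <;> simp)
    (by apply hom_ext <;> simp)

lemma comul_eq (a : Q) : Coalgebra.comul (R := ℂ) a = comulHom a := rfl

lemma counit_eq (a : Q) : Coalgebra.counit (R := ℂ) a = counitHom a := rfl

/-- The values of the antipode on the generators. -/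
def antipodeGen : Gen → Qᵐᵒᵖ
  | .E => .op (-(E * Kinv))
  | .F => .op (-(K * F))
  | .K => .op Kinv
  | .Kinv => .op K

lemma antipodeGen_rel ⦃x y : Free⦄ (h : Rel x y) :
    FreeAlgebra.lift ℂ antipodeGen x = FreeAlgebra.lift ℂ antipodeGen y := by
  apply MulOpposite.unop_injective
  have e3 : ∀ x, K * (E * x) = -(E * (K * x)) := fun x => by
    rw [← mul_assoc, K_mul_E, neg_mul, mul_assoc]
  have e5 : ∀ x, Kinv * (E * x) = -(E * (Kinv * x)) := fun x => by
    rw [← mul_assoc, Kinv_mul_E, neg_mul, mul_assoc]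
  have e7 : ∀ x, E * (E * x) = 0 := fun x => by rw [← mul_assoc, E_mul_E, zero_mul]
  have e8 : ∀ x, F * (F * x) = 0 := fun x => by rw [← mul_assoc, F_mul_F, zero_mul]
  induction h with
  | K_Kinv => simp [antipodeGen, K_mul_Kinv]
  | Kinv_K => simp [antipodeGen, Kinv_mul_K]
  | K_E => simp [antipodeGen, mul_assoc, e3, K_mul_Kinv]
  | K_F => simp [antipodeGen, mul_assoc, K_mul_F, K_mul_Kinv]
  | E_F =>
    simp [antipodeGen, mul_assoc, K_mul_F, K_mul_Kinv, Kinv_mul_K, Kinv_mul_F, F_mul_E, K_mul_E,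
      smul_sub]
    abel
  | E_sq => simp [antipodeGen, sq, mul_assoc, e5, e7]
  | F_sq => simp [antipodeGen, sq, mul_assoc, K_mul_F, e8]
  | K_four => simp [antipodeGen, Kinv_pow_four]

/-- The antipode of `Q`, as an algebra map to the opposite algebra. -/
def antipodeHom : Q →ₐ[ℂ] Qᵐᵒᵖ := lift antipodeGen antipodeGen_rel

@[simp] lemma antipodeHom_E : antipodeHom E = .op (-(E * Kinv)) := lift_mk _ antipodeGen_rel _
@[simp] lemma antipodeHom_F : antipodeHom F = .op (-(K * F)) := lift_mk _ antipodeGen_rel _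
@[simp] lemma antipodeHom_K : antipodeHom K = .op Kinv := lift_mk _ antipodeGen_rel _
@[simp] lemma antipodeHom_Kinv : antipodeHom Kinv = .op K := lift_mk _ antipodeGen_rel _

/-- The antipode of `Q`, as a linear map. -/
def antipodeLin : Q →ₗ[ℂ] Q :=
  (MulOpposite.opLinearEquiv ℂ).symm.toLinearMap ∘ₗ antipodeHom.toLinearMap

lemma antipodeLin_apply (a : Q) : antipodeLin a = (antipodeHom a).unop := rfl

lemma antipodeLin_mul (a b : Q) : antipodeLin (a * b) = antipodeLin b * antipodeLin a := by
  simp [antipodeLin_apply]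

lemma induction_gen {p : Q → Prop} (hc : ∀ c : ℂ, p (algebraMap ℂ Q c))
    (hE : p E) (hF : p F) (hK : p K) (hKinv : p Kinv)
    (hadd : ∀ a b, p a → p b → p (a + b)) (hmul : ∀ a b, p a → p b → p (a * b)) (a : Q) :
    p a := by
  obtain ⟨x, rfl⟩ : ∃ x, mk x = a := RingQuot.mkAlgHom_surjective ℂ Rel a
  induction x using FreeAlgebra.induction with
  | grade0 r => simpa using hc r
  | grade1 g =>
    cases g
    · exact hE
    · exact hF
    · exact hK
    · exact hKinv
  | mul a b ha hb => simpa using hmul _ _ ha hb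
  | add a b ha hb => simpa using hadd _ _ ha hb

lemma antipode_left (a : Q) :
    LinearMap.mul' ℂ Q (antipodeLin.rTensor Q (comulHom a)) = algebraMap ℂ Q (counitHom a) := by
  induction a using induction_gen with
  | hc c => simp [Algebra.algebraMap_eq_smul_one, Algebra.TensorProduct.one_def, antipodeLin_apply]
  | hE => simp [antipodeLin_apply, mul_assoc, Kinv_mul_K]
  | hF => simp [antipodeLin_apply]
  | hK => simp [antipodeLin_apply, Kinv_mul_K]
  | hKinv => simp [antipodeLin_apply, K_mul_Kinv]
  | hadd a b ha hb => simp [ha, hb]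
  | hmul a b ha hb =>
    have key : ∀ x y : Q ⊗[ℂ] Q, LinearMap.mul' ℂ Q (antipodeLin.rTensor Q x) =
        algebraMap ℂ Q (counitHom a) → LinearMap.mul' ℂ Q (antipodeLin.rTensor Q (x * y)) =
          algebraMap ℂ Q (counitHom a) * LinearMap.mul' ℂ Q (antipodeLin.rTensor Q y) := by
      intro x y hx
      induction y with
      | zero => simp
      | add y z hy hz => simp [mul_add, hy, hz]
      | tmul c d =>
        have : ∀ x : Q ⊗[ℂ] Q, LinearMap.mul' ℂ Q (antipodeLin.rTensor Q (x * c ⊗ₜ[ℂ] d)) =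
            antipodeLin c * LinearMap.mul' ℂ Q (antipodeLin.rTensor Q x) * d := by
          intro x
          induction x with
          | zero => simp
          | add x z hx hz => simp [add_mul, mul_add, hx, hz]
          | tmul e f => simp [antipodeLin_mul, mul_assoc]
        rw [this, hx, ← Algebra.commutes, mul_assoc]
        simp
    rw [map_mul, key _ _ ha, hb, map_mul, map_mul]

lemma antipode_right (a : Q) :
    LinearMap.mul' ℂ Q (antipodeLin.lTensor Q (comulHom a)) = algebraMap ℂ Q (counitHom a) := by
  induction a using induction_gen with
  | hc c => simp [Algebra.algebraMap_eq_smul_one, Algebra.TensorProduct.one_def, antipodeLin_apply]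
  | hE => simp [antipodeLin_apply]
  | hF => simp [antipodeLin_apply, ← mul_assoc, Kinv_mul_K]
  | hK => simp [antipodeLin_apply, K_mul_Kinv]
  | hKinv => simp [antipodeLin_apply, Kinv_mul_K]
  | hadd a b ha hb => simp [ha, hb]
  | hmul a b ha hb =>
    have key : ∀ x y : Q ⊗[ℂ] Q, LinearMap.mul' ℂ Q (antipodeLin.lTensor Q y) =
        algebraMap ℂ Q (counitHom b) → LinearMap.mul' ℂ Q (antipodeLin.lTensor Q (x * y)) =
          LinearMap.mul' ℂ Q (antipodeLin.lTensor Q x) * algebraMap ℂ Q (counitHom b) := by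
      intro x y hy
      induction x with
      | zero => simp
      | add x z hx hz => simp [add_mul, hx, hz]
      | tmul c d =>
        have : ∀ y : Q ⊗[ℂ] Q, LinearMap.mul' ℂ Q (antipodeLin.lTensor Q (c ⊗ₜ[ℂ] d * y)) =
            c * LinearMap.mul' ℂ Q (antipodeLin.lTensor Q y) * antipodeLin d := by
          intro y
          induction y with
          | zero => simp
          | add x z hx hz => simp [add_mul, mul_add, hx, hz]
          | tmul e f => simp [antipodeLin_mul, mul_assoc]
        rw [this, hy, mul_assoc, Algebra.commutes, ← mul_assoc]
        simp
    rw [map_mul, key _ _ hb, ha, map_mul, map_mul]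

/-- The Hopf algebra structure of `Q`. -/
instance : HopfAlgebra ℂ Q where
  antipode := antipodeLin
  mul_antipode_rTensor_comul := LinearMap.ext antipode_left
  mul_antipode_lTensor_comul := LinearMap.ext antipode_right

end Q

end RestrictedQuantumGroup

/-! ### Universal R-matrices -/

/-- An element `R` of `H ⊗ H` is a universal R-matrix of the bialgebra `H` if it is invertible,
`R Δ(a) = Δᵒᵖ(a) R` for all `a`, `(Δ ⊗ id)(R) = R₁₃ R₂₃` and `(id ⊗ Δ)(R) = R₁₃ R₁₂`;
the last two equations are written in `H ⊗ (H ⊗ H)`. -/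
structure IsUniversalRMatrix (k : Type*) {H : Type*} [CommRing k] [Ring H] [Bialgebra k H]
    (R : H ⊗[k] H) : Prop where
  isUnit : IsUnit R
  mul_comul : ∀ a : H,
    R * Coalgebra.comul a = TensorProduct.comm k H H (Coalgebra.comul a) * R
  comul_left :
    TensorProduct.assoc k H H H ((Coalgebra.comul (R := k) (A := H)).rTensor H R) =
      Algebra.TensorProduct.map (AlgHom.id k H) Algebra.TensorProduct.includeRight R *
        (1 ⊗ₜ[k] R : H ⊗[k] (H ⊗[k] H))
  comul_right :
    (Coalgebra.comul (R := k) (A := H)).lTensor H R =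
      Algebra.TensorProduct.map (AlgHom.id k H) Algebra.TensorProduct.includeRight R *
        Algebra.TensorProduct.map (AlgHom.id k H) Algebra.TensorProduct.includeLeft R

/-! ### The monoidal category of finite-dimensional representations of a bialgebra -/

/-- A finite-dimensional representation of the `k`-algebra `H`. -/
structure FinDimRep (k H : Type) [Field k] [Ring H] [Algebra k H] where
  /-- The underlying vector space. -/
  V : Type
  [addCommGroup : AddCommGroup V]
  [module : Module k V]
  [finite : FiniteDimensional k V]
  /-- The action of `H`. -/
  ρ : H →ₐ[k] Module.End k V

namespace FinDimRep

attribute [instance] FinDimRep.addCommGroup FinDimRep.module FinDimRep.finite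

section Category

variable {k H : Type} [Field k] [Ring H] [Algebra k H]

/-- Morphisms of representations: linear maps commuting with the action. -/
@[ext]
structure Hom (X Y : FinDimRep k H) where
  /-- The underlying linear map. -/
  hom : X.V →ₗ[k] Y.V
  comm : ∀ h : H, hom ∘ₗ X.ρ h = Y.ρ h ∘ₗ hom

instance : Category (FinDimRep k H) where
  Hom X Y := Hom X Y
  id X := ⟨LinearMap.id, fun _ => rfl⟩
  comp f g := ⟨g.hom ∘ₗ f.hom, fun h => by
    rw [LinearMap.comp_assoc, f.comm, ← LinearMap.comp_assoc, g.comm, LinearMap.comp_assoc]⟩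

@[ext]
lemma hom_ext {X Y : FinDimRep k H} {f g : X ⟶ Y} (h : f.hom = g.hom) : f = g := Hom.ext h

@[simp] lemma id_hom (X : FinDimRep k H) : Hom.hom (𝟙 X) = LinearMap.id := rfl

@[simp] lemma comp_hom {X Y Z : FinDimRep k H} (f : X ⟶ Y) (g : Y ⟶ Z) :
    (f ≫ g).hom = g.hom ∘ₗ f.hom := rfl

/-- An isomorphism of representations from a linear equivalence commuting with the action. -/
def mkIso {X Y : FinDimRep k H} (e : X.V ≃ₗ[k] Y.V)
    (h : ∀ a : H, e.toLinearMap ∘ₗ X.ρ a = Y.ρ a ∘ₗ e.toLinearMap) : X ≅ Y where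
  hom := ⟨e.toLinearMap, h⟩
  inv := ⟨e.symm.toLinearMap, fun a => by
    ext y
    have := LinearMap.congr_fun (h a) (e.symm y)
    simp only [LinearMap.comp_apply, LinearEquiv.coe_coe, LinearEquiv.apply_symm_apply] at this ⊢
    rw [← this, LinearEquiv.symm_apply_apply]⟩
  hom_inv_id := by ext x; simp
  inv_hom_id := by ext x; simp

@[simp] lemma mkIso_hom_hom {X Y : FinDimRep k H} (e : X.V ≃ₗ[k] Y.V)
    (h : ∀ a : H, e.toLinearMap ∘ₗ X.ρ a = Y.ρ a ∘ₗ e.toLinearMap) :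
    (mkIso e h).hom.hom = e.toLinearMap := rfl

@[simp] lemma mkIso_inv_hom {X Y : FinDimRep k H} (e : X.V ≃ₗ[k] Y.V)
    (h : ∀ a : H, e.toLinearMap ∘ₗ X.ρ a = Y.ρ a ∘ₗ e.toLinearMap) :
    (mkIso e h).inv.hom = e.symm.toLinearMap := rfl

/-- The action of `H ⊗ H` on `V ⊗ W`, `(a ⊗ b) . (v ⊗ w) = (a . v) ⊗ (b . w)`. -/
def act₂ {V W : Type} [AddCommGroup V] [Module k V] [AddCommGroup W] [Module k W]
    (ρ : H →ₐ[k] Module.End k V) (σ : H →ₐ[k] Module.End k W) :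
    H ⊗[k] H →ₐ[k] Module.End k (V ⊗[k] W) :=
  (Module.endTensorEndAlgHom (R := k) (S := k) (A := k) (M := V) (N := W)).comp
    (Algebra.TensorProduct.map ρ σ)

@[simp] lemma act₂_tmul {V W : Type} [AddCommGroup V] [Module k V] [AddCommGroup W] [Module k W]
    (ρ : H →ₐ[k] Module.End k V) (σ : H →ₐ[k] Module.End k W) (a b : H) :
    act₂ ρ σ (a ⊗ₜ b) = TensorProduct.map (ρ a) (σ b) := rfl

lemma act₂_natural {X X' Y Y' : FinDimRep k H} (f : Hom X X') (g : Hom Y Y') (z : H ⊗[k] H) :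
    TensorProduct.map f.hom g.hom ∘ₗ act₂ X.ρ Y.ρ z =
      act₂ X'.ρ Y'.ρ z ∘ₗ TensorProduct.map f.hom g.hom := by
  induction z with
  | zero => simp
  | add x y hx hy => simp only [map_add, LinearMap.comp_add, LinearMap.add_comp, hx, hy]
  | tmul a b => simp only [act₂_tmul, ← TensorProduct.map_comp, f.comm, g.comm]

end Category

section Monoidal

variable {k H : Type} [Field k] [Ring H] [Bialgebra k H]

section Actions

variable {V W U : Type} [AddCommGroup V] [Module k V] [AddCommGroup W] [Module k W]
  [AddCommGroup U] [Module k U]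

/-- The action of `H` on `V ⊗ W` through the comultiplication. -/
def tensorAct (ρ : H →ₐ[k] Module.End k V) (σ : H →ₐ[k] Module.End k W) :
    H →ₐ[k] Module.End k (V ⊗[k] W) :=
  (act₂ ρ σ).comp (Bialgebra.comulAlgHom k H)

variable (k H) in
/-- The action of `H` on `k` through the counit. -/
def trivAct : H →ₐ[k] Module.End k k :=
  (Algebra.lmul k k).comp (Bialgebra.counitAlgHom k H)

lemma tensorAct_apply (ρ : H →ₐ[k] Module.End k V) (σ : H →ₐ[k] Module.End k W) (a : H) :
    tensorAct ρ σ a = act₂ ρ σ (Coalgebra.comul a) := rfl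

/-- The action of `H ⊗ (H ⊗ H)` on `V ⊗ (W ⊗ U)`. -/
def act₃ (ρ : H →ₐ[k] Module.End k V) (σ : H →ₐ[k] Module.End k W)
    (τ : H →ₐ[k] Module.End k U) : H ⊗[k] (H ⊗[k] H) →ₐ[k] Module.End k (V ⊗[k] (W ⊗[k] U)) :=
  (Module.endTensorEndAlgHom (R := k) (S := k) (A := k) (M := V) (N := W ⊗[k] U)).comp
    (Algebra.TensorProduct.map ρ (act₂ σ τ))

lemma assoc_act₂ (ρ : H →ₐ[k] Module.End k V) (σ : H →ₐ[k] Module.End k W)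
    (τ : H →ₐ[k] Module.End k U) (z : H ⊗[k] H) :
    (TensorProduct.assoc k V W U).toLinearMap ∘ₗ act₂ (tensorAct ρ σ) τ z =
      act₃ ρ σ τ (TensorProduct.assoc k H H H
        ((Coalgebra.comul (R := k) (A := H)).rTensor H z)) ∘ₗ
      (TensorProduct.assoc k V W U).toLinearMap := by
  induction z with
  | zero => simp
  | add x y hx hy => simp only [map_add, LinearMap.comp_add, LinearMap.add_comp, hx, hy]
  | tmul a b =>
    rw [act₂_tmul, tensorAct_apply, LinearMap.rTensor_tmul]
    generalize (Coalgebra.comul (R := k) a : H ⊗[k] H) = w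
    induction w with
    | zero => simp
    | add x y hx hy =>
      simp only [map_add, LinearMap.comp_add, LinearMap.add_comp, TensorProduct.add_tmul,
        TensorProduct.map_add_left, hx, hy]
    | tmul c d => exact TensorProduct.ext_threefold fun x y z => rfl

lemma act₃_lTensor_comul (ρ : H →ₐ[k] Module.End k V) (σ : H →ₐ[k] Module.End k W)
    (τ : H →ₐ[k] Module.End k U) (z : H ⊗[k] H) :
    act₃ ρ σ τ ((Coalgebra.comul (R := k) (A := H)).lTensor H z) =
      act₂ ρ (tensorAct σ τ) z := by
  induction z with
  | zero => simp
  | add x y hx hy => simp only [map_add, hx, hy]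
  | tmul a b => rfl

lemma assoc_tensorAct (ρ : H →ₐ[k] Module.End k V) (σ : H →ₐ[k] Module.End k W)
    (τ : H →ₐ[k] Module.End k U) (a : H) :
    (TensorProduct.assoc k V W U).toLinearMap ∘ₗ tensorAct (tensorAct ρ σ) τ a =
      tensorAct ρ (tensorAct σ τ) a ∘ₗ (TensorProduct.assoc k V W U).toLinearMap := by
  rw [tensorAct_apply, assoc_act₂, Coalgebra.coassoc_apply, act₃_lTensor_comul, tensorAct_apply]

lemma lid_act₂ (ρ : H →ₐ[k] Module.End k V) (z : H ⊗[k] H) :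
    (TensorProduct.lid k V).toLinearMap ∘ₗ act₂ (trivAct k H) ρ z =
      ρ (TensorProduct.lid k H ((Coalgebra.counit (R := k) (A := H)).rTensor H z)) ∘ₗ
        (TensorProduct.lid k V).toLinearMap := by
  induction z with
  | zero => simp
  | add x y hx hy => simp only [map_add, LinearMap.comp_add, LinearMap.add_comp, hx, hy]
  | tmul a b => exact TensorProduct.ext' fun c x => by simp [trivAct, mul_smul]

lemma rid_act₂ (ρ : H →ₐ[k] Module.End k V) (z : H ⊗[k] H) :
    (TensorProduct.rid k V).toLinearMap ∘ₗ act₂ ρ (trivAct k H) z =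
      ρ (TensorProduct.rid k H ((Coalgebra.counit (R := k) (A := H)).lTensor H z)) ∘ₗ
        (TensorProduct.rid k V).toLinearMap := by
  induction z with
  | zero => simp
  | add x y hx hy => simp only [map_add, LinearMap.comp_add, LinearMap.add_comp, hx, hy]
  | tmul a b => exact TensorProduct.ext' fun x c => by simp [trivAct, mul_smul]

lemma lid_tensorAct (ρ : H →ₐ[k] Module.End k V) (a : H) :
    (TensorProduct.lid k V).toLinearMap ∘ₗ tensorAct (trivAct k H) ρ a =
      ρ a ∘ₗ (TensorProduct.lid k V).toLinearMap := by
  rw [tensorAct_apply, lid_act₂, Coalgebra.rTensor_counit_comul, TensorProduct.lid_tmul, one_smul]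

lemma rid_tensorAct (ρ : H →ₐ[k] Module.End k V) (a : H) :
    (TensorProduct.rid k V).toLinearMap ∘ₗ tensorAct ρ (trivAct k H) a =
      ρ a ∘ₗ (TensorProduct.rid k V).toLinearMap := by
  rw [tensorAct_apply, rid_act₂, Coalgebra.lTensor_counit_comul, TensorProduct.rid_tmul, one_smul]

end Actions

/-- The tensor product of representations, with `H` acting through the comultiplication. -/
def tensor (X Y : FinDimRep k H) : FinDimRep k H where
  V := X.V ⊗[k] Y.V
  ρ := tensorAct X.ρ Y.ρ

/-- The trivial representation, with `H` acting on `k` through the counit. -/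
def triv : FinDimRep k H where
  V := k
  ρ := trivAct k H

/-- The tensor product of morphisms. -/
def tensorMap {X X' Y Y' : FinDimRep k H} (f : Hom X X') (g : Hom Y Y') :
    Hom (tensor X Y) (tensor X' Y') where
  hom := TensorProduct.map f.hom g.hom
  comm _ := act₂_natural f g _

/-- The associator, which is that of vector spaces. -/
def assocIso (X Y Z : FinDimRep k H) : tensor (tensor X Y) Z ≅ tensor X (tensor Y Z) :=
  mkIso (X := tensor (tensor X Y) Z) (Y := tensor X (tensor Y Z))
    (TensorProduct.assoc k X.V Y.V Z.V) (assoc_tensorAct X.ρ Y.ρ Z.ρ)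

/-- The left unitor, which is that of vector spaces. -/
def lidIso (X : FinDimRep k H) : tensor triv X ≅ X :=
  mkIso (X := tensor triv X) (TensorProduct.lid k X.V) (lid_tensorAct X.ρ)

/-- The right unitor, which is that of vector spaces. -/
def ridIso (X : FinDimRep k H) : tensor X triv ≅ X :=
  mkIso (X := tensor X triv) (TensorProduct.rid k X.V) (rid_tensorAct X.ρ)

/-- The monoidal category of finite-dimensional representations of the bialgebra `H`. -/
instance : MonoidalCategory (FinDimRep k H) where
  tensorObj := tensor
  tensorUnit := triv
  tensorHom f g := tensorMap f g
  whiskerLeft X _ _ f := tensorMap (𝟙 X) f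
  whiskerRight f Y := tensorMap f (𝟙 Y)
  associator := assocIso
  leftUnitor := lidIso
  rightUnitor := ridIso
  tensorHom_def f g := by
    apply hom_ext
    exact TensorProduct.ext' fun _ _ => rfl
  id_tensorHom_id X Y := by
    apply hom_ext
    exact TensorProduct.ext' fun _ _ => rfl
  tensorHom_comp_tensorHom f₁ f₂ g₁ g₂ := by
    apply hom_ext
    exact TensorProduct.ext' fun _ _ => rfl
  whiskerLeft_id X Y := by
    apply hom_ext
    exact TensorProduct.ext' fun _ _ => rfl
  id_whiskerRight X Y := by
    apply hom_ext
    exact TensorProduct.ext' fun _ _ => rfl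
  associator_naturality f₁ f₂ f₃ := by
    apply hom_ext
    exact TensorProduct.ext_threefold fun _ _ _ => rfl
  leftUnitor_naturality {X Y} f := by
    apply hom_ext
    exact TensorProduct.ext' fun (c : k) x => (map_smul f.hom c x).symm
  rightUnitor_naturality f := by
    apply hom_ext
    exact TensorProduct.ext' fun x (c : k) => (map_smul f.hom c x).symm
  pentagon W X Y Z := by
    apply hom_ext
    exact TensorProduct.ext_fourfold fun _ _ _ _ => rfl
  triangle X Y := by
    apply hom_ext
    exact TensorProduct.ext_threefold fun x (c : k) y => (TensorProduct.smul_tmul c x y).symm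

end Monoidal

end FinDimRep

end

namespace RestrictedQuantumGroup

namespace Q

/-! ### The dimension of `Q` -/

/-! Dimension. The relations bring every element to a combination of the 16 ordered monomials `E ^ a
* F ^ b * K ^ c` (`span_monomial`). They are independent because each fourth root of unity `κ`
induces a 4-dimensional module on which evaluation at the generator sends such a monomial to `κ ^ c`
times a basis vector indexed by `(a, b)`; a Vandermonde argument in `κ` finishes
(`linearIndependent_monomial`).

No braiding, no R-matrix. Let `χ` be the character `E, F ↦ 0`, `K ↦ -1`. A braiding with the line
`χ`, or the element `(χ ⊗ id)(R)`, gives a linear endomorphism `G` of each module. Compatibility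
with `Δ` and `Δᵒᵖ` makes `G` anticommute with `E` and `F`. The hexagons, or the coproduct formulas
for `R`, give `G = G ⊗ G` on tensor products and `G² = 1`, since `χ ⊗ χ` is trivial; and `G` fixes
invariant vectors. On the two-dimensional simple module of highest weight `i`, anticommutation and
`G² = 1` force `G = ± diag(1, -1)`, so `G ⊗ G` is `-1` on the span of the two mixed tensors. That
span contains the nonzero invariant `pairingVector`, a contradiction
(`false_of_fixes_pairingVector`).

Commutativity up to isomorphism. It suffices to find a unit `R` with `R Δ(a) = Δᵒᵖ(a) R`, without
the coproduct formulas (`exists_cocommutator`). The central idempotents `(1 ± K²) / 2` cut `Q ⊗ Q`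
into four corners, and `R` may be chosen in each independently. Where `K² = 1`, `E` and `F` commute;
where `K² = -1`, the generators behave as on two-dimensional simple modules. Explicit intertwiners
exist for even-even, even-odd and odd-odd; the flip handles odd-even. -/

lemma Kinv_eq : Kinv = K ^ 3 := by
  calc Kinv = Kinv * (K * K ^ 3) := by rw [← pow_succ', K_pow_four, mul_one]
    _ = K ^ 3 := by rw [← mul_assoc, Kinv_mul_K, one_mul]

/-- Elements satisfying the defining relations, with `K⁻¹ = K ^ 3` eliminated, define an algebra
map out of `Q`. -/
lemma exists_algHom {A : Type*} [Ring A] [Algebra ℂ A] (e f k : A) (hk : k ^ 4 = 1)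
    (hke : k * e = -(e * k)) (hkf : k * f = -(f * k))
    (hef : e * f - f * e = (2 * Complex.I)⁻¹ • (k - k ^ 3)) (he : e * e = 0) (hf : f * f = 0) :
    ∃ φ : Q →ₐ[ℂ] A, φ E = e ∧ φ F = f ∧ φ K = k ∧ φ Kinv = k ^ 3 := by
  let v : Gen → A := fun g => match g with
    | .E => e | .F => f | .K => k | .Kinv => k ^ 3
  have hk1 : k * k ^ 3 = 1 := by rw [← pow_succ', hk]
  have hk2 : k ^ 3 * k = 1 := by rw [← pow_succ, hk]
  have hv : ∀ ⦃x y⦄, Rel x y → FreeAlgebra.lift ℂ v x = FreeAlgebra.lift ℂ v y := by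
    intro x y h
    induction h with
    | K_Kinv => simpa [v] using hk1
    | Kinv_K => simpa [v] using hk2
    | K_E =>
      simp only [map_mul, map_neg, FreeAlgebra.lift_ι_apply, v]
      rw [hke, neg_mul, mul_assoc, hk1, mul_one]
    | K_F =>
      simp only [map_mul, map_neg, FreeAlgebra.lift_ι_apply, v]
      rw [hkf, neg_mul, mul_assoc, hk1, mul_one]
    | E_F => simpa only [map_sub, map_mul, map_smul, FreeAlgebra.lift_ι_apply] using hef
    | E_sq => simpa [v, sq] using he
    | F_sq => simpa [v, sq] using hf
    | K_four => simpa [v] using hk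
  exact ⟨lift v hv, lift_mk v hv _, lift_mk v hv _, lift_mk v hv _, lift_mk v hv _⟩

/-- The ordered monomial `E ^ a * F ^ b * K ^ c`. -/
def monomial (j : (Fin 2 × Fin 2) × Fin 4) : Q :=
  E ^ (j.1.1 : ℕ) * F ^ (j.1.2 : ℕ) * K ^ (j.2 : ℕ)

/-- The exponent of `K` is arbitrary here, since it only matters modulo 4; this spares reducing
exponents after each multiplication. -/
lemma monomial_mem_span (a b : Fin 2) (c : ℕ) :
    E ^ (a : ℕ) * F ^ (b : ℕ) * K ^ c ∈ Submodule.span ℂ (Set.range monomial) := by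
  have h : K ^ c = K ^ (c % 4) := by
    conv_lhs => rw [← Nat.div_add_mod c 4, pow_add, pow_mul, K_pow_four, one_pow, one_mul]
  rw [h]
  exact Submodule.subset_span ⟨((a, b), ⟨c % 4, Nat.mod_lt _ (by norm_num)⟩), rfl⟩

lemma K_cube_mul_F : K ^ 3 * F = -(F * K ^ 3) := by
  rw [← Kinv_eq, Kinv_mul_F]

/-- The span is stable under left multiplication by every generator, hence a left ideal, and it
contains 1. -/
lemma span_monomial : Submodule.span ℂ (Set.range monomial) = ⊤ := by
  have key : ∀ x y : Q, y ∈ Submodule.span ℂ (Set.range monomial) →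
      x * y ∈ Submodule.span ℂ (Set.range monomial) := by
    intro x
    have of_monomial : ∀ z : Q, (∀ j, z * monomial j ∈ Submodule.span ℂ (Set.range monomial)) →
        ∀ y ∈ Submodule.span ℂ (Set.range monomial),
          z * y ∈ Submodule.span ℂ (Set.range monomial) := by
      intro z hz y hy
      induction hy using Submodule.span_induction with
      | mem y hy => obtain ⟨j, rfl⟩ := hy; exact hz j
      | zero => simp
      | add y y' _ _ h h' => rw [mul_add]; exact add_mem h h'
      | smul c y _ h => rw [mul_smul_comm]; exact Submodule.smul_mem _ _ h
    have hKmul : ∀ y ∈ Submodule.span ℂ (Set.range monomial),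
        K * y ∈ Submodule.span ℂ (Set.range monomial) := by
      refine of_monomial _ ?_
      rintro ⟨⟨a, b⟩, c⟩
      have h := monomial_mem_span a b (c + 1)
      fin_cases a <;> fin_cases b <;>
        simp only [monomial, pow_zero, one_mul, mul_one, pow_succ'] at h ⊢
      · exact h
      · rw [← mul_assoc, K_mul_F, neg_mul, mul_assoc]; exact neg_mem h
      · rw [← mul_assoc, K_mul_E, neg_mul, mul_assoc]; exact neg_mem h
      · rw [← mul_assoc, ← mul_assoc, K_mul_E, neg_mul, mul_assoc E K F, K_mul_F, mul_neg, neg_neg,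
          ← mul_assoc, mul_assoc]
        exact h
    induction x using induction_gen with
    | hc c =>
      intro y hy
      rw [← Algebra.smul_def]
      exact Submodule.smul_mem _ _ hy
    | hadd x x' h h' => intro y hy; rw [add_mul]; exact add_mem (h y hy) (h' y hy)
    | hmul x x' h h' => intro y hy; rw [mul_assoc]; exact h _ (h' y hy)
    | hK => exact hKmul
    | hKinv =>
      intro y hy
      rw [Kinv_eq, pow_succ, pow_two, mul_assoc, mul_assoc]
      exact hKmul _ (hKmul _ (hKmul _ hy))
    | hE =>
      refine of_monomial _ ?_
      rintro ⟨⟨a, b⟩, c⟩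
      have h := monomial_mem_span 1 b c
      fin_cases a
      · simpa [monomial, mul_assoc] using h
      · simp [monomial, ← mul_assoc, E_mul_E]
    | hF =>
      refine of_monomial _ ?_
      rintro ⟨⟨a, b⟩, c⟩
      fin_cases a <;> fin_cases b <;>
        simp only [monomial, pow_zero, pow_one, one_mul, mul_one]
      · simpa using monomial_mem_span 0 1 c
      · simp [← mul_assoc, F_mul_F]
      · rw [← mul_assoc, F_mul_E, Kinv_eq, sub_mul, smul_mul_assoc, sub_mul, ← pow_succ', ← pow_add]
        refine sub_mem ?_ (Submodule.smul_mem _ _ (sub_mem ?_ ?_))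
        · simpa using monomial_mem_span 1 1 c
        · simpa using monomial_mem_span 0 0 (c + 1)
        · simpa using monomial_mem_span 0 0 (3 + c)
      -- In `F E F` the reordered term `E F F` vanishes, so only the commutator contributes.
      · have : F * (E * F * K ^ (c : ℕ)) =
            (2 * Complex.I)⁻¹ • (F * K ^ (c + 1 : ℕ) - F * K ^ (3 + c : ℕ)) := by
          rw [← mul_assoc, ← mul_assoc, F_mul_E, Kinv_eq, sub_mul, mul_assoc E F F, F_mul_F,
            smul_mul_assoc, sub_mul K, K_mul_F, K_cube_mul_F, mul_zero, zero_sub, ← smul_neg,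
            smul_mul_assoc, pow_add K 3, pow_succ' K c]
          congr 1
          noncomm_ring
        rw [this]
        refine Submodule.smul_mem _ _ (sub_mem ?_ ?_)
        · simpa using monomial_mem_span 0 1 (c + 1)
        · simpa using monomial_mem_span 0 1 (3 + c)
  rw [eq_top_iff]
  intro x _
  simpa using key x 1 (by simpa using monomial_mem_span 0 0 0)

/-- For a fourth root of unity `κ`, evaluation at the generator of the module induced from the
character `K ↦ κ`, which has the basis `v, F v, E v, E F v`. -/
lemma exists_eval_induced (κ : ℂ) (hκ : κ ^ 4 = 1) :
    ∃ φ : Q →ₗ[ℂ] Fin 4 → ℂ, ∀ (a b : Fin 2) (c : ℕ),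
      φ (E ^ (a : ℕ) * F ^ (b : ℕ) * K ^ c) = Pi.single (finProdFinEquiv (a, b)) (κ ^ c) := by
  set d : ℂ := (2 * Complex.I)⁻¹ * (κ - κ ^ 3) with hd
  set k : Matrix (Fin 4) (Fin 4) ℂ := Matrix.diagonal ![κ, -κ, -κ, κ] with hk
  have hpow : ∀ c : ℕ, k ^ c = Matrix.diagonal (![κ, -κ, -κ, κ] ^ c) := fun c => by
    rw [hk, Matrix.diagonal_pow]
  -- The columns express the action on `v, F v, E v, E F v`. The scalar `d` is the eigenvalue of `E
  -- F - F E` on `v`, so `F E v = E F v - d v`; on `F v` the sign of `K` is reversed, so `F E F v =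
  -- d F v`.
  obtain ⟨φ, hE, hF, hK, -⟩ := exists_algHom
    (!![0, 0, 0, 0; 0, 0, 0, 0; 1, 0, 0, 0; 0, 1, 0, 0] : Matrix (Fin 4) (Fin 4) ℂ)
    !![0, 0, -d, 0; 1, 0, 0, d; 0, 0, 0, 0; 0, 0, 1, 0] k
    (by
      rw [hpow, ← Matrix.diagonal_one]
      congr 1
      ext i
      fin_cases i <;> simp [hκ, Even.neg_pow (show Even 4 by decide)])
    (by ext i j; fin_cases i <;> fin_cases j <;> simp [hk, Matrix.vecMul_diagonal])
    (by
      ext i j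
      fin_cases i <;> fin_cases j <;> simp [hk, Matrix.vecMul_diagonal, mul_comm])
    (by
      rw [hpow]
      ext i j
      fin_cases i <;> fin_cases j <;>
        simp [hk, hd, Odd.neg_pow (show Odd 3 by decide)] <;>
        ring)
    (by ext i j; fin_cases i <;> fin_cases j <;> simp [Matrix.mul_apply, Fin.sum_univ_four])
    (by ext i j; fin_cases i <;> fin_cases j <;> simp [Matrix.mul_apply, Fin.sum_univ_four])
  refine ⟨⟨⟨fun x => (φ x).mulVec (Pi.single 0 1), fun x y => by rw [map_add, Matrix.add_mulVec]⟩,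
    fun c x => by simp only [map_smul, Matrix.smul_mulVec, RingHom.id_apply]⟩, fun a b c => ?_⟩
  simp only [LinearMap.coe_mk, AddHom.coe_mk, map_mul, map_pow, hE, hF, hK, hpow]
  ext i
  fin_cases a <;> fin_cases b <;> fin_cases i <;>
    simp [finProdFinEquiv, Matrix.vecMul_diagonal]

/-- For fixed `(a, b)`, a relation evaluated in the modules induced from `κ = i ^ j` says that a
polynomial of degree at most 3 in `κ` vanishes at all four fourth roots of unity. -/
lemma linearIndependent_monomial : LinearIndependent ℂ monomial := by
  rw [Fintype.linearIndependent_iff]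
  rintro x hx ⟨⟨a, b⟩, c⟩
  have hinj : Function.Injective fun j : Fin 4 => Complex.I ^ (j : ℕ) := by
    intro i j h
    fin_cases i <;> fin_cases j <;> first | rfl | (norm_num [Complex.ext_iff, pow_succ] at h)
  refine congrFun (Matrix.eq_zero_of_forall_index_sum_pow_mul_eq_zero
    (v := fun c => x ((a, b), c)) hinj fun j => ?_) c
  obtain ⟨φ, hφ⟩ := exists_eval_induced (Complex.I ^ (j : ℕ))
    (by rw [← pow_mul, mul_comm, pow_mul, Complex.I_pow_four, one_pow])
  have h := congrFun (congrArg φ hx) (finProdFinEquiv (a, b))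
  simp only [map_sum, map_smul, monomial, hφ, Finset.sum_apply, Pi.smul_apply, smul_eq_mul,
    map_zero, Pi.zero_apply, Pi.single_apply, finProdFinEquiv.injective.eq_iff] at h
  rw [Fintype.sum_prod_type] at h
  simpa [mul_comm] using h

/-- The basis of `Q` of ordered monomials. -/
noncomputable def monomialBasis : Module.Basis ((Fin 2 × Fin 2) × Fin 4) ℂ Q :=
  .mk linearIndependent_monomial span_monomial.ge

lemma finrank_eq : Module.finrank ℂ Q = 16 := by
  rw [Module.finrank_eq_card_basis monomialBasis]
  simp

end Q

end RestrictedQuantumGroup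

/-! ### Universal R-matrices and characters -/

section RMatrix

variable {k H : Type*} [CommRing k] [Ring H] [Bialgebra k H]

/-- The evaluation of a character on the left tensor factor. -/
noncomputable def evalLeft {A : Type*} [Ring A] [Algebra k A] (χ : H →ₐ[k] k) :
    H ⊗[k] A →ₐ[k] A :=
  (Algebra.TensorProduct.lid k A).toAlgHom.comp (Algebra.TensorProduct.map χ (AlgHom.id k A))

@[simp] lemma evalLeft_tmul {A : Type*} [Ring A] [Algebra k A] (χ : H →ₐ[k] k) (a : H) (b : A) :
    evalLeft χ (a ⊗ₜ[k] b) = χ a • b := by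
  simp [evalLeft]

/-- Applying `χ` to the first factor of `(id ⊗ Δ)(R) = R₁₃ R₁₂` shows that `g = (χ ⊗ id)(R)` is
grouplike: the right side becomes `(1 ⊗ g)(g ⊗ 1)`. -/
lemma IsUniversalRMatrix.comul_evalLeft {R : H ⊗[k] H} (hR : IsUniversalRMatrix k R)
    (χ : H →ₐ[k] k) : Coalgebra.comul (R := k) (evalLeft χ R) = evalLeft χ R ⊗ₜ evalLeft χ R := by
  have h := congrArg (evalLeft χ) hR.comul_right
  have h₁ : ∀ z : H ⊗[k] H, evalLeft χ ((Coalgebra.comul (R := k) (A := H)).lTensor H z) =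
      Coalgebra.comul (R := k) (evalLeft χ z) := by
    intro z
    induction z with
    | zero => simp
    | add x y hx hy => simp only [map_add, hx, hy]
    | tmul a b => simp
  have h₂ : ∀ z : H ⊗[k] H, evalLeft χ (Algebra.TensorProduct.map (AlgHom.id k H)
      (Algebra.TensorProduct.includeRight : H →ₐ[k] H ⊗[k] H) z) = 1 ⊗ₜ evalLeft χ z := by
    intro z
    induction z with
    | zero => simp
    | add x y hx hy => simp only [map_add, TensorProduct.tmul_add, hx, hy]
    | tmul a b => simp
  have h₃ : ∀ z : H ⊗[k] H, evalLeft χ (Algebra.TensorProduct.map (AlgHom.id k H)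
      (Algebra.TensorProduct.includeLeft : H →ₐ[k] H ⊗[k] H) z) = evalLeft χ z ⊗ₜ 1 := by
    intro z
    induction z with
    | zero => simp
    | add x y hx hy => simp only [map_add, TensorProduct.add_tmul, hx, hy]
    | tmul a b => simp [TensorProduct.smul_tmul']
  rw [h₁, map_mul, h₂, h₃] at h
  simpa using h

/-- Applying `χ ⊗ ψ` to the first two factors of `(Δ ⊗ id)(R) = R₁₃ R₂₃` turns the convolution of
characters into multiplication; `θ` is that convolution. -/
lemma IsUniversalRMatrix.evalLeft_mul_evalLeft {R : H ⊗[k] H} (hR : IsUniversalRMatrix k R)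
    (χ ψ θ : H →ₐ[k] k) (hθ : ∀ a : H, ψ (evalLeft χ (Coalgebra.comul (R := k) a)) = θ a) :
    evalLeft χ R * evalLeft ψ R = evalLeft θ R := by
  have h := congrArg (fun z => evalLeft ψ (evalLeft χ z)) hR.comul_left
  have h₁ : ∀ z : H ⊗[k] H, evalLeft ψ (evalLeft χ (TensorProduct.assoc k H H H
      ((Coalgebra.comul (R := k) (A := H)).rTensor H z))) = evalLeft θ z := by
    intro z
    induction z with
    | zero => simp
    | add x y hx hy => simp only [map_add, hx, hy]
    | tmul a b =>
      rw [evalLeft_tmul, ← hθ, LinearMap.rTensor_tmul]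
      generalize (Coalgebra.comul (R := k) a : H ⊗[k] H) = w
      induction w with
      | zero => simp
      | add x y hx hy => simp only [map_add, TensorProduct.add_tmul, hx, hy, add_smul]
      | tmul c d => simp [mul_smul]
  have h₂ : ∀ z : H ⊗[k] H, evalLeft ψ (evalLeft χ (Algebra.TensorProduct.map (AlgHom.id k H)
      (Algebra.TensorProduct.includeRight : H →ₐ[k] H ⊗[k] H) z)) = evalLeft χ z := by
    intro z
    induction z with
    | zero => simp
    | add x y hx hy => simp only [map_add, hx, hy]
    | tmul a b => simp
  simp only [h₁, map_mul, h₂, evalLeft_tmul, map_one, one_smul] at h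
  exact h.symm

/-- The counit is its own convolution square, so this element is idempotent; it is also a unit. -/
lemma IsUniversalRMatrix.evalLeft_counit {R : H ⊗[k] H} (hR : IsUniversalRMatrix k R) :
    evalLeft (Bialgebra.counitAlgHom k H) R = 1 := by
  have hu : IsUnit (evalLeft (A := H) (Bialgebra.counitAlgHom k H) R) := hR.isUnit.map _
  refine hu.mul_left_cancel ?_
  rw [mul_one]
  refine hR.evalLeft_mul_evalLeft _ _ _ fun a => ?_
  have : evalLeft (Bialgebra.counitAlgHom k H) (Coalgebra.comul (R := k) a) = a := by
    have h := congrArg (TensorProduct.lid k H) (Coalgebra.rTensor_counit_comul (R := k) a)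
    rw [TensorProduct.lid_tmul, one_smul] at h
    exact h
  rw [this]

lemma IsUniversalRMatrix.counit_evalLeft {R : H ⊗[k] H} (hR : IsUniversalRMatrix k R)
    (χ : H →ₐ[k] k) : Coalgebra.counit (R := k) (evalLeft χ R) • (1 : H) = 1 := by
  have hu : IsUnit (evalLeft (A := H) χ R) := hR.isUnit.map _
  have h := congrArg (TensorProduct.lid k H)
    (Coalgebra.rTensor_counit_comul (R := k) (evalLeft χ R))
  rw [hR.comul_evalLeft, LinearMap.rTensor_tmul, TensorProduct.lid_tmul, TensorProduct.lid_tmul,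
    one_smul] at h
  refine hu.mul_right_cancel ?_
  rw [smul_one_mul, h, one_mul]

end RMatrix

/-! ### Braidings of the category of representations -/

namespace FinDimRep

section Braiding

variable {k H : Type} [Field k] [Ring H] [Bialgebra k H] [BraidedCategory (FinDimRep k H)]
  {V W U V' : Type} [AddCommGroup V] [Module k V] [FiniteDimensional k V]
  [AddCommGroup W] [Module k W] [FiniteDimensional k W]
  [AddCommGroup V'] [Module k V'] [FiniteDimensional k V']
  [AddCommGroup U] [Module k U] [FiniteDimensional k U]

/-- The linear map underlying a braiding. -/
def braidMap (ρ : H →ₐ[k] Module.End k V) (σ : H →ₐ[k] Module.End k W) :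
    V ⊗[k] W →ₗ[k] W ⊗[k] V :=
  (β_ (⟨V, ρ⟩ : FinDimRep k H) ⟨W, σ⟩).hom.hom

lemma braidMap_tensorAct (ρ : H →ₐ[k] Module.End k V) (σ : H →ₐ[k] Module.End k W) (a : H)
    (z : V ⊗[k] W) :
    braidMap ρ σ (tensorAct ρ σ a z) = tensorAct σ ρ a (braidMap ρ σ z) :=
  LinearMap.congr_fun ((β_ (⟨V, ρ⟩ : FinDimRep k H) ⟨W, σ⟩).hom.comm a) z

lemma braidMap_naturality_left {ρ : H →ₐ[k] Module.End k V} {ρ' : H →ₐ[k] Module.End k V'}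
    (f : V →ₗ[k] V') (hf : ∀ a, f ∘ₗ ρ a = ρ' a ∘ₗ f) (σ : H →ₐ[k] Module.End k W)
    (v : V) (w : W) :
    braidMap ρ' σ (f v ⊗ₜ w) = TensorProduct.map LinearMap.id f (braidMap ρ σ (v ⊗ₜ w)) :=
  let φ : (⟨V, ρ⟩ : FinDimRep k H) ⟶ ⟨V', ρ'⟩ := ⟨f, hf⟩
  LinearMap.congr_fun (congrArg Hom.hom (BraidedCategory.braiding_naturality_left φ ⟨W, σ⟩))
    (v ⊗ₜ w)

lemma braidMap_naturality_right {ρ : H →ₐ[k] Module.End k V} {ρ' : H →ₐ[k] Module.End k V'}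
    (f : V →ₗ[k] V') (hf : ∀ a, f ∘ₗ ρ a = ρ' a ∘ₗ f) (σ : H →ₐ[k] Module.End k W)
    (v : V) (w : W) :
    braidMap σ ρ' (w ⊗ₜ f v) = TensorProduct.map f LinearMap.id (braidMap σ ρ (w ⊗ₜ v)) :=
  let φ : (⟨V, ρ⟩ : FinDimRep k H) ⟶ ⟨V', ρ'⟩ := ⟨f, hf⟩
  LinearMap.congr_fun (congrArg Hom.hom (BraidedCategory.braiding_naturality_right ⟨W, σ⟩ φ))
    (w ⊗ₜ v)

lemma braidMap_hexagon_forward (ρ : H →ₐ[k] Module.End k V) (σ : H →ₐ[k] Module.End k W)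
    (τ : H →ₐ[k] Module.End k U) (v : V) (w : W) (u : U) :
    TensorProduct.assoc k W U V (braidMap ρ (tensorAct σ τ) (v ⊗ₜ (w ⊗ₜ u))) =
      TensorProduct.map LinearMap.id (braidMap ρ τ)
        (TensorProduct.assoc k W V U (braidMap ρ σ (v ⊗ₜ w) ⊗ₜ u)) :=
  LinearMap.congr_fun (congrArg Hom.hom
    (BraidedCategory.hexagon_forward (⟨V, ρ⟩ : FinDimRep k H) ⟨W, σ⟩ ⟨U, τ⟩)) ((v ⊗ₜ w) ⊗ₜ u)

lemma braidMap_hexagon_reverse (ρ : H →ₐ[k] Module.End k V) (σ : H →ₐ[k] Module.End k W)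
    (τ : H →ₐ[k] Module.End k U) (v : V) (w : W) (u : U) :
    (TensorProduct.assoc k U V W).symm (braidMap (tensorAct ρ σ) τ ((v ⊗ₜ w) ⊗ₜ u)) =
      TensorProduct.map (braidMap ρ τ) LinearMap.id
        ((TensorProduct.assoc k V U W).symm (v ⊗ₜ braidMap σ τ (w ⊗ₜ u))) :=
  LinearMap.congr_fun (congrArg Hom.hom
    (BraidedCategory.hexagon_reverse (⟨V, ρ⟩ : FinDimRep k H) ⟨W, σ⟩ ⟨U, τ⟩)) (v ⊗ₜ (w ⊗ₜ u))

lemma braidMap_trivAct_left (ρ : H →ₐ[k] Module.End k V) (v : V) :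
    braidMap (trivAct k H) ρ (1 ⊗ₜ[k] v) = v ⊗ₜ[k] 1 := by
  have h : TensorProduct.rid k V (braidMap (trivAct k H) ρ (1 ⊗ₜ[k] v)) =
      TensorProduct.lid k V (1 ⊗ₜ[k] v) :=
    LinearMap.congr_fun (congrArg Hom.hom (braiding_rightUnitor (⟨V, ρ⟩ : FinDimRep k H)))
      ((1 : k) ⊗ₜ[k] v)
  apply (TensorProduct.rid k V).injective
  rw [h, TensorProduct.lid_tmul, TensorProduct.rid_tmul]

lemma braidMap_trivAct_right (ρ : H →ₐ[k] Module.End k V) (v : V) :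
    braidMap ρ (trivAct k H) (v ⊗ₜ[k] 1) = 1 ⊗ₜ[k] v := by
  have h : TensorProduct.lid k V (braidMap ρ (trivAct k H) (v ⊗ₜ[k] 1)) =
      TensorProduct.rid k V (v ⊗ₜ[k] 1) :=
    LinearMap.congr_fun (congrArg Hom.hom (braiding_leftUnitor (⟨V, ρ⟩ : FinDimRep k H)))
      (v ⊗ₜ[k] (1 : k))
  apply (TensorProduct.lid k V).injective
  rw [h, TensorProduct.lid_tmul, TensorProduct.rid_tmul]

/-- The action of `H` on `k` through a character. -/
def characterAct (χ : H →ₐ[k] k) : H →ₐ[k] Module.End k k := (Algebra.lmul k k).comp χ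

/-- The endomorphism of the vector space of a representation obtained by braiding with a
character. -/
def braidCharacter (χ : H →ₐ[k] k) (ρ : H →ₐ[k] Module.End k V) : V →ₗ[k] V :=
  (TensorProduct.rid k V).toLinearMap ∘ₗ braidMap (characterAct χ) ρ ∘ₗ TensorProduct.mk k k V 1

lemma braidMap_characterAct (χ : H →ₐ[k] k) (ρ : H →ₐ[k] Module.End k V) (v : V) :
    braidMap (characterAct χ) ρ (1 ⊗ₜ[k] v) = braidCharacter χ ρ v ⊗ₜ[k] 1 := by
  apply (TensorProduct.rid k V).injective
  rw [TensorProduct.rid_tmul, one_smul]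
  rfl

/-- The braiding from `χ ⊗ V` to `V ⊗ χ` is `H`-linear; with the line removed, `H` acts through `(χ
⊗ id)Δ` at the source and `(χ ⊗ id)Δᵒᵖ` at the target. -/
lemma braidCharacter_comul (χ : H →ₐ[k] k) (ρ : H →ₐ[k] Module.End k V) (a : H) (v : V) :
    braidCharacter χ ρ (ρ (evalLeft χ (Coalgebra.comul (R := k) a)) v) =
      ρ (evalLeft χ (TensorProduct.comm k H H (Coalgebra.comul (R := k) a)))
        (braidCharacter χ ρ v) := by
  have h := braidMap_tensorAct (characterAct χ) ρ a (1 ⊗ₜ[k] v)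
  have h₁ : ∀ z : H ⊗[k] H, act₂ (characterAct χ) ρ z (1 ⊗ₜ[k] v) =
      1 ⊗ₜ[k] ρ (evalLeft χ z) v := by
    intro z
    induction z with
    | zero => simp
    | add u v hu hv => simp only [map_add, LinearMap.add_apply, TensorProduct.tmul_add, hu, hv]
    | tmul b c => simp [characterAct, TensorProduct.smul_tmul']
  have h₂ : ∀ (z : H ⊗[k] H) (v : V), act₂ ρ (characterAct χ) z (v ⊗ₜ[k] 1) =
      ρ (evalLeft χ (TensorProduct.comm k H H z)) v ⊗ₜ[k] 1 := by
    intro z y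
    induction z with
    | zero => simp
    | add u v hu hv => simp only [map_add, LinearMap.add_apply, TensorProduct.add_tmul, hu, hv]
    | tmul b c => simp [characterAct, TensorProduct.smul_tmul]
  rw [tensorAct_apply, tensorAct_apply, h₁, braidMap_characterAct, braidMap_characterAct, h₂] at h
  simpa using congrArg (TensorProduct.rid k V) h

/-- This is the forward hexagon with a line as the object moved past the other two. -/
lemma braidCharacter_tensorAct (χ : H →ₐ[k] k) (ρ : H →ₐ[k] Module.End k V)
    (σ : H →ₐ[k] Module.End k W) :
    braidCharacter χ (tensorAct ρ σ) =
      TensorProduct.map (braidCharacter χ ρ) (braidCharacter χ σ) := by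
  refine TensorProduct.ext' fun v w => ?_
  have h := braidMap_hexagon_forward (characterAct χ) ρ σ 1 v w
  rw [braidMap_characterAct, braidMap_characterAct, TensorProduct.assoc_tmul,
    TensorProduct.map_tmul, LinearMap.id_apply, braidMap_characterAct,
    ← TensorProduct.assoc_tmul] at h
  simpa using congrArg (TensorProduct.rid k (V ⊗[k] W))
    ((TensorProduct.assoc k V W k).injective h)

/-- An invariant vector is a morphism from the tensor unit; naturality reduces to the braiding with
the unit, which is forced. -/
lemma braidCharacter_invariant (χ : H →ₐ[k] k) (ρ : H →ₐ[k] Module.End k V) (v : V)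
    (hv : ∀ a : H, ρ a v = Coalgebra.counit (R := k) a • v) : braidCharacter χ ρ v = v := by
  have hf : ∀ a, LinearMap.toSpanSingleton k V v ∘ₗ trivAct k H a =
      ρ a ∘ₗ LinearMap.toSpanSingleton k V v := by
    intro a
    ext
    simp [trivAct, hv]
  have h := braidMap_naturality_right (LinearMap.toSpanSingleton k V v) hf (characterAct χ) 1 1
  rw [braidMap_trivAct_right, TensorProduct.map_tmul, LinearMap.toSpanSingleton_apply_one,
    braidMap_characterAct] at h
  simpa using congrArg (TensorProduct.rid k V) h

/-- By the reverse hexagon, braiding twice with `χ` is braiding once with `χ ⊗ χ`, which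
multiplication of scalars identifies with the tensor unit. -/
lemma braidCharacter_braidCharacter (χ : H →ₐ[k] k)
    (hχ : ∀ a : H, χ (evalLeft χ (Coalgebra.comul (R := k) a)) = Coalgebra.counit (R := k) a)
    (ρ : H →ₐ[k] Module.End k V) (v : V) : braidCharacter χ ρ (braidCharacter χ ρ v) = v := by
  have hm : ∀ a, LinearMap.mul' k k ∘ₗ tensorAct (characterAct χ) (characterAct χ) a =
      trivAct k H a ∘ₗ LinearMap.mul' k k := by
    intro a
    have h : ∀ z : H ⊗[k] H, LinearMap.mul' k k ∘ₗ act₂ (characterAct χ) (characterAct χ) z =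
        Algebra.lmul k k (χ (evalLeft χ z)) ∘ₗ LinearMap.mul' k k := by
      intro z
      induction z with
      | zero => simp
      | add u v hu hv => simp only [map_add, LinearMap.comp_add, LinearMap.add_comp, hu, hv]
      | tmul b c => ext; simp [characterAct]
    rw [tensorAct_apply, h, hχ]
    rfl
  have h := braidMap_hexagon_reverse (characterAct χ) (characterAct χ) ρ 1 1 v
  rw [braidMap_characterAct, TensorProduct.assoc_symm_tmul, TensorProduct.map_tmul,
    braidMap_characterAct, LinearMap.id_apply, LinearEquiv.symm_apply_eq,
    TensorProduct.assoc_tmul] at h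
  have h₁ := braidMap_naturality_left (LinearMap.mul' k k) hm ρ (1 ⊗ₜ 1) v
  rw [h, LinearMap.mul'_apply, mul_one,
    braidMap_trivAct_left] at h₁
  simpa using (congrArg (TensorProduct.rid k V) h₁).symm

end Braiding

end FinDimRep

namespace RestrictedQuantumGroup

namespace Q

/-! ### The obstruction to a braiding -/

/-- The character `E ↦ 0`, `F ↦ 0`, `K ↦ -1`. -/
lemma exists_signCharacter : ∃ χ : Q →ₐ[ℂ] ℂ, χ E = 0 ∧ χ F = 0 ∧ χ K = -1 ∧ χ Kinv = -1 := by
  obtain ⟨χ, hE, hF, hK, hKinv⟩ := exists_algHom (0 : ℂ) 0 (-1) (by norm_num) (by norm_num)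
    (by norm_num) (by norm_num) (by norm_num) (by norm_num)
  exact ⟨χ, hE, hF, hK, by rw [hKinv]; norm_num⟩

/-- The two-dimensional simple module of highest weight `i`. -/
lemma exists_simpleRep : ∃ ρ : Q →ₐ[ℂ] Module.End ℂ (ℂ × ℂ),
    (∀ x, ρ E x = (x.2, 0)) ∧ (∀ x, ρ F x = (0, x.1)) ∧
    (∀ x, ρ K x = (Complex.I * x.1, -(Complex.I * x.2))) ∧
    ∀ x, ρ Kinv x = (-(Complex.I * x.1), Complex.I * x.2) := by
  set k : Module.End ℂ (ℂ × ℂ) :=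
    LinearMap.prodMap (Complex.I • LinearMap.id) (-(Complex.I • LinearMap.id)) with hk
  have hk_apply : ∀ x, k x = (Complex.I * x.1, -(Complex.I * x.2)) := fun x => by simp [hk]
  have hk_cube : k ^ 3 = -k := by
    refine LinearMap.ext fun x => ?_
    simp [pow_succ, hk_apply, ← mul_assoc]
  obtain ⟨ρ, hE, hF, hK, hKinv⟩ := exists_algHom
    (LinearMap.inl ℂ ℂ ℂ ∘ₗ LinearMap.snd ℂ ℂ ℂ : Module.End ℂ (ℂ × ℂ))
    (LinearMap.inr ℂ ℂ ℂ ∘ₗ LinearMap.fst ℂ ℂ ℂ) k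
    (by refine LinearMap.ext fun x => ?_; simp [pow_succ, hk_apply, ← mul_assoc])
    (by refine LinearMap.ext fun x => ?_; simp [hk_apply])
    (by refine LinearMap.ext fun x => ?_; simp [hk_apply])
    (by
      refine LinearMap.ext fun x => ?_
      rw [hk_cube]
      have hI : (2 * Complex.I) ≠ 0 := by simp
      ext
      · simp [hk_apply]; field_simp; rw [Complex.I_sq]; ring
      · simp [hk_apply]; field_simp; rw [Complex.I_sq]; ring)
    (by refine LinearMap.ext fun x => ?_; simp)
    (by refine LinearMap.ext fun x => ?_; simp)
  refine ⟨ρ, fun x => by simp [hE], fun x => by simp [hF], fun x => by rw [hK, hk_apply],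
    fun x => ?_⟩
  rw [hKinv, hk_cube, LinearMap.neg_apply, hk_apply]
  simp

/-- The vector spanning the trivial submodule of the tensor square of the simple module of highest
weight `i`. -/
def pairingVector : (ℂ × ℂ) ⊗[ℂ] (ℂ × ℂ) :=
  (0, 1) ⊗ₜ (1, 0) - Complex.I • ((1, 0) ⊗ₜ (0, 1))

/-- The coefficient `-i` in `pairingVector` makes the two contributions to each of `E` and `F`
cancel; both of its terms have `K`-weight `i * (-i) = 1`. -/
lemma tensorAct_pairingVector {ρ : Q →ₐ[ℂ] Module.End ℂ (ℂ × ℂ)}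
    (hE : ∀ x, ρ E x = (x.2, 0)) (hF : ∀ x, ρ F x = (0, x.1))
    (hK : ∀ x, ρ K x = (Complex.I * x.1, -(Complex.I * x.2)))
    (hKinv : ∀ x, ρ Kinv x = (-(Complex.I * x.1), Complex.I * x.2)) (a : Q) :
    FinDimRep.tensorAct ρ ρ a pairingVector = counitHom a • pairingVector := by
  have hI : ∀ c : ℂ, ((c, 0) : ℂ × ℂ) = c • (1, 0) := fun c => by simp
  have hI' : ∀ c : ℂ, ((0, c) : ℂ × ℂ) = c • (0, 1) := fun c => by simp
  have h0 : ((0, 0) : ℂ × ℂ) = 0 := rfl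
  induction a using induction_gen with
  | hc c => simp [Algebra.algebraMap_eq_smul_one]
  | hE =>
    simp only [FinDimRep.tensorAct_apply, comul_eq, comulHom_E, counitHom_E, map_add,
      FinDimRep.act₂_tmul, pairingVector, map_sub, map_smul, LinearMap.add_apply,
      TensorProduct.map_tmul, hE, hK, map_one, Module.End.one_apply]
    simp [h0, hI Complex.I, -Prod.smul_mk]
  | hF =>
    simp only [FinDimRep.tensorAct_apply, comul_eq, comulHom_F, counitHom_F, map_add,
      FinDimRep.act₂_tmul, pairingVector, map_sub, map_smul, LinearMap.add_apply,
      TensorProduct.map_tmul, hF, hKinv, map_one, Module.End.one_apply]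
    simp [h0, hI' Complex.I, ← TensorProduct.smul_tmul', -Prod.smul_mk]
  | hK =>
    simp only [FinDimRep.tensorAct_apply, comul_eq, comulHom_K, counitHom_K,
      FinDimRep.act₂_tmul, pairingVector, map_sub, map_smul, TensorProduct.map_tmul, hK]
    simp only [mul_one, mul_zero, neg_zero, ← mul_neg_one Complex.I]
    rw [hI, hI', TensorProduct.smul_tmul_smul, TensorProduct.smul_tmul_smul]
    simp
  | hKinv =>
    simp only [FinDimRep.tensorAct_apply, comul_eq, comulHom_Kinv, counitHom_Kinv,
      FinDimRep.act₂_tmul, pairingVector, map_sub, map_smul, TensorProduct.map_tmul, hKinv]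
    simp only [mul_one, mul_zero, neg_zero, ← mul_neg_one Complex.I]
    rw [hI, hI', TensorProduct.smul_tmul_smul, TensorProduct.smul_tmul_smul]
    simp
  | hadd a b ha hb => rw [map_add, map_add, LinearMap.add_apply, ha, hb, add_smul]
  | hmul a b ha hb =>
    rw [map_mul, map_mul, Module.End.mul_apply, hb, map_smul, ha, smul_smul, mul_comm]

lemma false_of_fixes_pairingVector {ρ : Q →ₐ[ℂ] Module.End ℂ (ℂ × ℂ)}
    (hE : ∀ x, ρ E x = (x.2, 0)) (hF : ∀ x, ρ F x = (0, x.1)) (G : ℂ × ℂ →ₗ[ℂ] ℂ × ℂ)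
    (hGE : ∀ x, G (ρ E x) = -ρ E (G x)) (hGF : ∀ x, G (ρ F x) = -ρ F (G x))
    (hGG : ∀ x, G (G x) = x)
    (hG : TensorProduct.map G G pairingVector = pairingVector) : False := by
  -- `G` preserves the kernel of `E`, which is the line of `(1, 0)`; anticommutation with `F` then
  -- gives `-t` on `(0, 1)`.
  obtain ⟨t, ht⟩ : ∃ t : ℂ, G (1, 0) = t • (1, 0) := by
    refine ⟨(G (1, 0)).1, ?_⟩
    have h := hGE (1, 0)
    simp only [hE, ← Prod.zero_eq_mk, map_zero] at h
    have h' : (G (1, 0)).2 = 0 := by simpa [eq_comm, Prod.ext_iff] using h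
    ext <;> simp [h']
  have ht' : G (0, 1) = -t • (0, 1) := by
    have h := hGF (1, 0)
    simp only [hF, ht] at h
    simpa using h
  have htt : t * t = 1 := by
    have h := hGG (1, 0)
    rw [ht, map_smul, ht, smul_smul] at h
    simpa [Prod.ext_iff] using h
  rw [pairingVector, map_sub, map_smul, TensorProduct.map_tmul, TensorProduct.map_tmul, ht, ht',
    TensorProduct.smul_tmul_smul, TensorProduct.smul_tmul_smul] at hG
  -- This functional reads off the coefficient of `(0, 1) ⊗ (1, 0)`: it is `-t² = -1` on one side
  -- and `1` on the other.
  have h := congrArg (LinearMap.mul' ℂ ℂ ∘ₗ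
    TensorProduct.map (LinearMap.snd ℂ ℂ ℂ) (LinearMap.fst ℂ ℂ ℂ)) hG
  simp [htt] at h
  norm_num at h

lemma evalLeft_sign_sign {χ : Q →ₐ[ℂ] ℂ} (hE : χ E = 0) (hF : χ F = 0) (hK : χ K = -1)
    (hKinv : χ Kinv = -1) (a : Q) :
    χ (evalLeft χ (Coalgebra.comul (R := ℂ) a)) = Coalgebra.counit (R := ℂ) a := by
  have h : (χ.comp (evalLeft χ)).comp comulHom = counitHom := by
    apply hom_ext <;> simp [hE, hF, hK, hKinv]
  exact DFunLike.congr_fun h a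

theorem isEmpty_braidedCategory : IsEmpty (BraidedCategory (FinDimRep ℂ Q)) := by
  refine ⟨fun _ => ?_⟩
  obtain ⟨χ, hE, hF, hK, hKinv⟩ := exists_signCharacter
  obtain ⟨ρ, rE, rF, rK, rKinv⟩ := exists_simpleRep
  refine false_of_fixes_pairingVector rE rF (FinDimRep.braidCharacter χ ρ) (fun x => ?_)
    (fun x => ?_) (FinDimRep.braidCharacter_braidCharacter χ (evalLeft_sign_sign hE hF hK hKinv) ρ)
    ?_
  -- `(χ ⊗ id)Δ(E) = E`, whereas `(χ ⊗ id)Δᵒᵖ(E) = χ(K) E = -E`; for `F` the signs are exchanged.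
  · have h := FinDimRep.braidCharacter_comul χ ρ E x
    simpa [comul_eq, hE, hK] using h
  · have h := FinDimRep.braidCharacter_comul χ ρ F x
    simpa [comul_eq, hF, hKinv, neg_eq_iff_eq_neg] using h
  · rw [← FinDimRep.braidCharacter_tensorAct]
    exact FinDimRep.braidCharacter_invariant χ _ _ (tensorAct_pairingVector rE rF rK rKinv)

/-- The element `g = (χ ⊗ id)(R)` acts as the `G` of the braided case, so no passage from R-matrices
to braidings is needed. -/
theorem not_exists_isUniversalRMatrix : ¬ ∃ R : Q ⊗[ℂ] Q, IsUniversalRMatrix ℂ R := by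
  rintro ⟨R, hR⟩
  obtain ⟨χ, hE, hF, hK, hKinv⟩ := exists_signCharacter
  obtain ⟨ρ, rE, rF, rK, rKinv⟩ := exists_simpleRep
  have hcomm : ∀ a : Q, evalLeft χ R * evalLeft χ (comulHom a) =
      evalLeft χ (TensorProduct.comm ℂ Q Q (comulHom a)) * evalLeft χ R := fun a => by
    rw [← map_mul, ← map_mul]
    exact congrArg _ (hR.mul_comul a)
  refine false_of_fixes_pairingVector rE rF (ρ (evalLeft χ R)) (fun x => ?_) (fun x => ?_)
    (fun x => ?_) ?_
  · have h : evalLeft χ R * E = -(E * evalLeft χ R) := by simpa [hE, hK] using hcomm E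
    rw [← Module.End.mul_apply, ← map_mul, h, map_neg, map_mul]
    rfl
  · have h : evalLeft χ R * F = -(F * evalLeft χ R) := by
      simpa [hF, hKinv, neg_eq_iff_eq_neg] using hcomm F
    rw [← Module.End.mul_apply, ← map_mul, h, map_neg, map_mul]
    rfl
  · rw [← Module.End.mul_apply, ← map_mul, hR.evalLeft_mul_evalLeft χ χ
      (Bialgebra.counitAlgHom ℂ Q) (evalLeft_sign_sign hE hF hK hKinv), hR.evalLeft_counit, map_one,
      Module.End.one_apply]
  -- Since `g` is grouplike, it acts on the tensor square as `g ⊗ g`, and on the invariant vector by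
  -- `ε(g) = 1`.
  · have h := tensorAct_pairingVector rE rF rK rKinv (evalLeft χ R)
    rw [FinDimRep.tensorAct_apply, hR.comul_evalLeft, FinDimRep.act₂_tmul, ← counit_eq] at h
    rw [h]
    have h₁ := congrArg counitHom (hR.counit_evalLeft χ)
    rw [map_smul, map_one, smul_eq_mul, mul_one] at h₁
    rw [h₁, one_smul]

end Q

end RestrictedQuantumGroup

/-! ### Conjugacy of the comultiplication and its opposite -/

/-- Intertwiners between two maps into a ring can be glued along a complete family of orthogonal
central idempotents. -/
lemma exists_unit_intertwining_of_corners {A α ι : Type*} [Ring A] [Fintype ι] [DecidableEq ι]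
    (ε : ι → A) (hsum : ∑ i, ε i = 1) (hmul : ∀ i j, ε i * ε j = if i = j then ε i else 0)
    (hcentral : ∀ i x, ε i * x = x * ε i) (δ δ' : α → A)
    (h : ∀ i, ∃ r r' : A, r * r' = ε i ∧ r' * r = ε i ∧
      ∀ x, r * (ε i * δ x) = ε i * δ' x * r) :
    ∃ R : Aˣ, ∀ x, R * δ x = δ' x * R := by
  choose r r' h₁ h₂ h₃ using h
  -- The `r i` need not lie in their corners, so the glued element uses `ε i * r i`; orthogonality
  -- kills the cross terms.
  have key : ∀ u v : ι → A, (∀ i, u i * v i = ε i) →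
      (∑ i, ε i * u i) * ∑ i, ε i * v i = 1 := by
    intro u v huv
    rw [Finset.sum_mul_sum, ← hsum]
    refine Finset.sum_congr rfl fun i _ => ?_
    have : ∀ j, ε i * u i * (ε j * v j) = if i = j then ε i else 0 := fun j => by
      rw [mul_assoc, ← mul_assoc (u i), ← hcentral j (u i), mul_assoc, ← mul_assoc, hmul]
      split_ifs with hij
      · rw [← hij, huv, hmul, if_pos rfl]
      · rw [zero_mul]
    simp [this]
  refine ⟨⟨∑ i, ε i * r i, ∑ i, ε i * r' i, key r r' h₁, key r' r h₂⟩, fun x => ?_⟩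
  change (∑ i, ε i * r i) * δ x = δ' x * ∑ i, ε i * r i
  rw [Finset.sum_mul, Finset.mul_sum]
  refine Finset.sum_congr rfl fun i _ => ?_
  rw [hcentral i (r i), mul_assoc, h₃, ← mul_assoc, hcentral i (δ' x), mul_assoc,
    hcentral, mul_assoc]

namespace RestrictedQuantumGroup

/-- The relations of the generators `E`, `F`, `K` in the corner of an idempotent `e` on which
`K ^ 2` acts as `s`. -/
structure CornerRel {A : Type*} [Ring A] [Algebra ℂ A] (s t : ℂ) (e a b k : A) : Prop where
  ee : e * e = e
  ea : e * a = a
  ae : a * e = a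
  eb : e * b = b
  be : b * e = b
  ek : e * k = k
  ke : k * e = k
  kk : k * k = s • e
  ka : k * a = -(a * k)
  kb : k * b = -(b * k)
  ba : b * a = a * b + t • k
  aa : a * a = 0
  bb : b * b = 0

/-- The rewriting rules of a corner towards the ordered monomials `a * b * k`. -/
lemma CornerRel.rules {A : Type*} [Ring A] [Algebra ℂ A] {s t : ℂ} {e a b k : A}
    (h : CornerRel s t e a b k) :
    (e * e = e ∧ e * a = a ∧ a * e = a ∧ e * b = b ∧ b * e = b ∧ e * k = k ∧ k * e = k ∧
      k * k = s • e ∧ k * a = -(a * k) ∧ k * b = -(b * k) ∧ b * a = a * b + t • k ∧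
      a * a = 0 ∧ b * b = 0) ∧
    (∀ x, e * (a * x) = a * x) ∧ (∀ x, a * (e * x) = a * x) ∧ (∀ x, e * (b * x) = b * x) ∧
    (∀ x, b * (e * x) = b * x) ∧ (∀ x, e * (k * x) = k * x) ∧ (∀ x, k * (e * x) = k * x) ∧
    (∀ x, k * (k * x) = s • (e * x)) ∧ (∀ x, k * (a * x) = -(a * (k * x))) ∧
    (∀ x, k * (b * x) = -(b * (k * x))) ∧ (∀ x, b * (a * x) = a * (b * x) + t • (k * x)) ∧
    (∀ x, a * (a * x) = 0) ∧ ∀ x, b * (b * x) = 0 := by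
  refine ⟨⟨h.ee, h.ea, h.ae, h.eb, h.be, h.ek, h.ke, h.kk, h.ka, h.kb, h.ba, h.aa, h.bb⟩, ?_⟩
  simp [← mul_assoc, h.ea, h.ae, h.eb, h.be, h.ek, h.ke, h.kk, h.ka, h.kb, h.ba, h.aa, h.bb,
    add_mul]

/-- The bilinear expansion of products in a tensor product of algebras. -/
lemma tensor_expand {A : Type*} [Ring A] [Algebra ℂ A] :
    ((∀ a b c d : A, a ⊗ₜ[ℂ] b * c ⊗ₜ[ℂ] d = (a * c) ⊗ₜ (b * d)) ∧
      (∀ a b c : A, a ⊗ₜ[ℂ] (b + c) = a ⊗ₜ b + a ⊗ₜ c) ∧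
      (∀ a b c : A, (a + b) ⊗ₜ[ℂ] c = a ⊗ₜ c + b ⊗ₜ c) ∧
      (∀ a b c : A, (a - b) ⊗ₜ[ℂ] c = a ⊗ₜ c - b ⊗ₜ c) ∧
      (∀ a b : A, (-a) ⊗ₜ[ℂ] b = -(a ⊗ₜ b)) ∧ (∀ a b : A, a ⊗ₜ[ℂ] (-b) = -(a ⊗ₜ b)) ∧
      (∀ a : A, a ⊗ₜ[ℂ] (0 : A) = 0) ∧ (∀ a : A, (0 : A) ⊗ₜ[ℂ] a = 0) ∧
      (∀ (c : ℂ) (a b : A), a ⊗ₜ[ℂ] (c • b) = c • a ⊗ₜ b) ∧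
      ∀ (c : ℂ) (a b : A), (c • a) ⊗ₜ[ℂ] b = c • a ⊗ₜ b) :=
  ⟨fun _ _ _ _ => Algebra.TensorProduct.tmul_mul_tmul .., TensorProduct.tmul_add,
    TensorProduct.add_tmul, TensorProduct.sub_tmul, TensorProduct.neg_tmul, TensorProduct.tmul_neg,
    fun a => TensorProduct.tmul_zero A a, fun a => TensorProduct.zero_tmul A a,
    fun c a b => TensorProduct.tmul_smul c a b, fun _ _ _ => rfl⟩

/-- `r` and `r'` are mutually inverse elements of the corner of the idempotent `ε`. -/
structure IsCornerInverse {A : Type*} [Ring A] (ε r r' : A) : Prop where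
  mul : r * r' = ε
  mul' : r' * r = ε
  left : ε * r = r
  right : r * ε = r

lemma IsCornerInverse.comp {A : Type*} [Ring A] {ε r r' p p' : A} (hp : IsCornerInverse ε p p')
    (hr : IsCornerInverse ε r r') : IsCornerInverse ε (p * r) (r' * p') where
  mul := by rw [mul_assoc, ← mul_assoc r, hr.mul, ← mul_assoc, hp.right, hp.mul]
  mul' := by rw [mul_assoc, ← mul_assoc p', hp.mul', hr.left, hr.mul']
  left := by rw [← mul_assoc, hp.left]
  right := by rw [mul_assoc, hr.right]

/-! ### Explicit intertwiners of `Δ` and `Δᵒᵖ` in the corners -/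

section Intertwiners

open Complex

variable {A : Type*} [Ring A] [Algebra ℂ A] {e a b k f c d l : A}

/-- Here `k² = e`, and `r` is the sign of the super flip: `-1` where both factors have `K = -1`, and
`1` elsewhere. As in the other corners, the identities follow by comparing coefficients of ordered
monomials. -/
lemma exists_intertwiner_even_even (h : CornerRel 1 0 e a b k) :
    ∃ r r' : A ⊗[ℂ] A, IsCornerInverse (e ⊗ₜ e) r r' ∧
      SemiconjBy r (e ⊗ₜ a + a ⊗ₜ k) (a ⊗ₜ e + k ⊗ₜ a) ∧
      SemiconjBy r (k ⊗ₜ b + b ⊗ₜ e) (b ⊗ₜ k + e ⊗ₜ b) ∧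
      SemiconjBy r (k ⊗ₜ k) (k ⊗ₜ k) := by
  obtain ⟨r, hr⟩ : ∃ r : A ⊗[ℂ] A,
    r = (2⁻¹ : ℂ) • (e ⊗ₜ e + k ⊗ₜ e + e ⊗ₜ k - k ⊗ₜ k) := ⟨_, rfl⟩
  refine ⟨r, r, ⟨?_, ?_, ?_, ?_⟩, ?_, ?_, ?_⟩ <;> simp only [SemiconjBy, hr] <;>
    simp only [mul_add, add_mul, sub_mul, mul_sub, smul_mul_assoc, mul_smul_comm,
      tensor_expand, h.rules] <;>
    match_scalars <;> ring

/-- `r` is `1` where the first factor has `K = 1` and `i K` on the second factor where it has `K =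
-1`. This makes `k ⊗ c` and `e ⊗ d` agree with `Δᵒᵖ`; the coefficients of `a ⊗ f` and `b ⊗ l` are
still wrong. -/
lemma exists_diagonal_intertwiner (h : CornerRel 1 0 e a b k) (g : CornerRel (-1) I f c d l) :
    ∃ r r' : A ⊗[ℂ] A, IsCornerInverse (e ⊗ₜ f) r r' ∧
      SemiconjBy r (e ⊗ₜ c + a ⊗ₜ l) (k ⊗ₜ c - I • a ⊗ₜ f) ∧
      SemiconjBy r (k ⊗ₜ d + b ⊗ₜ f) (e ⊗ₜ d + I • b ⊗ₜ l) ∧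
      SemiconjBy r (k ⊗ₜ l) (k ⊗ₜ l) := by
  obtain ⟨r, hr⟩ : ∃ r : A ⊗[ℂ] A, r = (2⁻¹ : ℂ) • ((e + k) ⊗ₜ f + I • (e - k) ⊗ₜ l) := ⟨_, rfl⟩
  refine ⟨r, r, ⟨?_, ?_, ?_, ?_⟩, ?_, ?_, ?_⟩ <;> simp only [SemiconjBy, hr] <;>
    simp only [mul_add, add_mul, sub_mul, mul_sub, smul_mul_assoc, mul_smul_comm,
      tensor_expand, h.rules, g.rules] <;>
    match_scalars <;> grind [I_mul_I]

/-- The square-zero term `b ⊗ c` commutes with the image of `E`, and its commutator with `e ⊗ d` is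
`-i b ⊗ l`. Moving the coefficient of `b ⊗ l` from `i` to `-1` requires the factor `(1 + i) / i = 1
- i`. -/
lemma exists_unipotent_intertwiner_F_E (h : CornerRel 1 0 e a b k)
    (g : CornerRel (-1) I f c d l) :
    ∃ r r' : A ⊗[ℂ] A, IsCornerInverse (e ⊗ₜ f) r r' ∧
      SemiconjBy r (k ⊗ₜ c - I • a ⊗ₜ f) (k ⊗ₜ c - I • a ⊗ₜ f) ∧
      SemiconjBy r (e ⊗ₜ d + I • b ⊗ₜ l) (-(b ⊗ₜ l) + e ⊗ₜ d) ∧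
      SemiconjBy r (k ⊗ₜ l) (k ⊗ₜ l) := by
  obtain ⟨r, r', hr⟩ : ∃ r r' : A ⊗[ℂ] A,
    r = e ⊗ₜ f + (1 - I) • b ⊗ₜ c ∧ r' = e ⊗ₜ f - (1 - I) • b ⊗ₜ c := ⟨_, _, rfl, rfl⟩
  refine ⟨r, r', ⟨?_, ?_, ?_, ?_⟩, ?_, ?_, ?_⟩ <;> simp only [SemiconjBy, hr] <;>
    simp only [mul_add, add_mul, sub_mul, mul_sub, smul_mul_assoc, mul_smul_comm,
      neg_mul, tensor_expand, h.rules, g.rules] <;>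
    match_scalars <;> grind [I_mul_I]

/-- The counterpart for `E`: the commutator of `(a * k) ⊗ (d * l)` with `k ⊗ c` is `i a ⊗ f`, and
the image of `F`, already correct, is unchanged. -/
lemma exists_unipotent_intertwiner_E_F (h : CornerRel 1 0 e a b k)
    (g : CornerRel (-1) I f c d l) :
    ∃ r r' : A ⊗[ℂ] A, IsCornerInverse (e ⊗ₜ f) r r' ∧
      SemiconjBy r (k ⊗ₜ c - I • a ⊗ₜ f) (a ⊗ₜ f + k ⊗ₜ c) ∧
      SemiconjBy r (-(b ⊗ₜ l) + e ⊗ₜ d) (-(b ⊗ₜ l) + e ⊗ₜ d) ∧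
      SemiconjBy r (k ⊗ₜ l) (k ⊗ₜ l) := by
  obtain ⟨r, r', hr⟩ : ∃ r r' : A ⊗[ℂ] A, r = e ⊗ₜ f + (1 - I) • (a * k) ⊗ₜ (d * l) ∧
    r' = e ⊗ₜ f - (1 - I) • (a * k) ⊗ₜ (d * l) := ⟨_, _, rfl, rfl⟩
  refine ⟨r, r', ⟨?_, ?_, ?_, ?_⟩, ?_, ?_, ?_⟩ <;> simp only [SemiconjBy, hr] <;>
    simp only [mul_add, add_mul, sub_mul, mul_sub, smul_mul_assoc, mul_smul_comm, mul_assoc,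
      mul_neg, neg_mul, tensor_expand, h.rules, g.rules] <;>
    match_scalars <;> grind [I_mul_I]

lemma exists_intertwiner_even_odd (h : CornerRel 1 0 e a b k) (g : CornerRel (-1) I f c d l) :
    ∃ r r' : A ⊗[ℂ] A, IsCornerInverse (e ⊗ₜ f) r r' ∧
      SemiconjBy r (e ⊗ₜ c + a ⊗ₜ l) (a ⊗ₜ f + k ⊗ₜ c) ∧
      SemiconjBy r (k ⊗ₜ d + b ⊗ₜ f) (-(b ⊗ₜ l) + e ⊗ₜ d) ∧
      SemiconjBy r (k ⊗ₜ l) (k ⊗ₜ l) := by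
  obtain ⟨r₁, r₁', h₁, hE₁, hF₁, hK₁⟩ := exists_diagonal_intertwiner h g
  obtain ⟨r₂, r₂', h₂, hE₂, hF₂, hK₂⟩ := exists_unipotent_intertwiner_F_E h g
  obtain ⟨r₃, r₃', h₃, hE₃, hF₃, hK₃⟩ := exists_unipotent_intertwiner_E_F h g
  exact ⟨_, _, h₃.comp (h₂.comp h₁), hE₃.mul_left (hE₂.mul_left hE₁),
    hF₃.mul_left (hF₂.mul_left hF₁), hK₃.mul_left (hK₂.mul_left hK₁)⟩

set_option maxHeartbeats 1000000 in
/-- On a tensor product of two simple modules in the corner, this is the flip up to signs. -/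
lemma exists_intertwiner_odd_odd (g : CornerRel (-1) I f c d l) :
    ∃ r r' : A ⊗[ℂ] A, IsCornerInverse (f ⊗ₜ f) r r' ∧
      SemiconjBy r (f ⊗ₜ c + c ⊗ₜ l) (c ⊗ₜ f + l ⊗ₜ c) ∧
      SemiconjBy r (-(l ⊗ₜ d) + d ⊗ₜ f) (-(d ⊗ₜ l) + f ⊗ₜ d) ∧
      SemiconjBy r (l ⊗ₜ l) (l ⊗ₜ l) := by
  -- The four terms act, up to sign, on highest ⊗ highest, lowest ⊗ lowest, lowest ⊗ highest and
  -- highest ⊗ lowest weight vectors; the last two exchange the weights. `r'` is `r` with its tensor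
  -- factors exchanged.
  obtain ⟨r, r', hr⟩ : ∃ r r' : A ⊗[ℂ] A,
      r = -((c * (d * l)) ⊗ₜ (c * (d * l))) + (c * d + I • l) ⊗ₜ (c * d + I • l) +
        I • (c * l) ⊗ₜ d - I • (d * l) ⊗ₜ c ∧
      r' = -((c * (d * l)) ⊗ₜ (c * (d * l))) + (c * d + I • l) ⊗ₜ (c * d + I • l) +
        I • d ⊗ₜ (c * l) - I • c ⊗ₜ (d * l) := ⟨_, _, rfl, rfl⟩
  refine ⟨r, r', ⟨?_, ?_, ?_, ?_⟩, ?_, ?_, ?_⟩ <;> simp only [SemiconjBy, hr] <;>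
    simp only [mul_add, add_mul, sub_mul, mul_sub, smul_mul_assoc, mul_smul_comm, mul_assoc,
      mul_neg, neg_mul, mul_zero, tensor_expand, g.rules] <;>
    match_scalars <;> grind [I_mul_I]

end Intertwiners

end RestrictedQuantumGroup

/-- An invertible element intertwining the comultiplication and its opposite makes the tensor
product of representations commutative. -/
lemma FinDimRep.nonempty_tensor_comm {k H : Type} [Field k] [Ring H] [Bialgebra k H]
    (R : (H ⊗[k] H)ˣ) (hR : ∀ a : H, (R : H ⊗[k] H) * Coalgebra.comul (R := k) a =
      TensorProduct.comm k H H (Coalgebra.comul (R := k) a) * R) (X Y : FinDimRep k H) :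
    Nonempty (X ⊗ Y ≅ Y ⊗ X) := by
  have hcomm : ∀ (z : H ⊗[k] H) (v : X.V ⊗[k] Y.V), TensorProduct.comm k X.V Y.V
      (act₂ X.ρ Y.ρ (TensorProduct.comm k H H z) v) =
        act₂ Y.ρ X.ρ z (TensorProduct.comm k X.V Y.V v) := by
    intro z v
    induction z with
    | zero => simp
    | add x y hx hy => simp only [map_add, LinearMap.add_apply, hx, hy]
    | tmul a b =>
      induction v with
      | zero => simp
      | add x y hx hy => simp only [map_add, hx, hy]
      | tmul x y => simp
  let e : X.V ⊗[k] Y.V ≃ₗ[k] Y.V ⊗[k] X.V :=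
    (LinearMap.GeneralLinearGroup.toLinearEquiv (Units.map (act₂ X.ρ Y.ρ).toMonoidHom R)).trans
      (TensorProduct.comm k X.V Y.V)
  have he : ∀ v, e v = TensorProduct.comm k X.V Y.V (act₂ X.ρ Y.ρ R v) := fun _ => rfl
  have key : ∀ (a : H) (v : X.V ⊗[k] Y.V), e (act₂ X.ρ Y.ρ (Coalgebra.comul (R := k) a) v) =
      act₂ Y.ρ X.ρ (Coalgebra.comul (R := k) a) (e v) := fun a v => by
    rw [he, he, ← Module.End.mul_apply, ← map_mul, hR, map_mul, Module.End.mul_apply, hcomm]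
  exact ⟨mkIso (X := tensor X Y) (Y := tensor Y X) e fun a => LinearMap.ext (key a)⟩

namespace RestrictedQuantumGroup

namespace Q

/-! ### Commutativity of the tensor product -/

lemma K_sq_mul (x : Q) : K ^ 2 * x = x * K ^ 2 := by
  induction x using induction_gen with
  | hc c => rw [Algebra.commutes]
  | hE => rw [pow_two, mul_assoc, K_mul_E, mul_neg, ← mul_assoc, K_mul_E, neg_mul, neg_neg,
      mul_assoc]
  | hF => rw [pow_two, mul_assoc, K_mul_F, mul_neg, ← mul_assoc, K_mul_F, neg_mul, neg_neg,
      mul_assoc]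
  | hK => rw [← pow_succ, ← pow_succ']
  | hKinv => rw [Kinv_eq, ← pow_add, ← pow_add]
  | hadd a b ha hb => rw [mul_add, add_mul, ha, hb]
  | hmul a b ha hb => rw [← mul_assoc, ha, mul_assoc, hb, mul_assoc]

/-- For `s = ± 1`, the central idempotent of `Q` projecting to the eigenspace of `K ^ 2` for the
eigenvalue `s`. -/
noncomputable def idem (s : ℂ) : Q := (2⁻¹ : ℂ) • (1 + s • K ^ 2)

lemma idem_mul_comm (s : ℂ) (x : Q) : idem s * x = x * idem s := by
  simp only [idem, smul_mul_assoc, mul_smul_comm, add_mul, mul_add, one_mul, mul_one, K_sq_mul]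

lemma idem_mul_idem (s t : ℂ) : idem s * idem t =
    (4⁻¹ : ℂ) • ((1 + s * t) • 1 + (s + t) • K ^ 2) := by
  have h : K ^ 2 * K ^ 2 = 1 := by rw [← pow_add, K_pow_four]
  simp only [idem, smul_mul_assoc, mul_smul_comm, add_mul, mul_add, one_mul, mul_one, h]
  module

lemma idem_mul_K_sq {s : ℂ} (hs : s * s = 1) : idem s * K ^ 2 = s • idem s := by
  have h : K ^ 2 * K ^ 2 = 1 := by rw [← pow_add, K_pow_four]
  simp only [idem, smul_mul_assoc, add_mul, one_mul, h]
  match_scalars <;> grind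

lemma idem_mul_Kinv {s : ℂ} (hs : s * s = 1) : idem s * Kinv = s • (idem s * K) := by
  rw [Kinv_eq, pow_succ, ← mul_assoc, idem_mul_K_sq hs, smul_mul_assoc]

lemma idem_mul_self {s : ℂ} (hs : s * s = 1) : idem s * idem s = idem s := by
  rw [idem_mul_idem, hs, idem]
  module

/-- In this corner `K⁻¹ = s K`, so `F E - E F = (s - 1) / (2 i) K`: `t` is `0` for `s = 1` and `i`
for `s = -1`. -/
lemma cornerRel {s t : ℂ} (hs : s * s = 1) (ht : 2 * Complex.I * t = s - 1) :
    CornerRel s t (idem s) (idem s * E) (idem s * F) (idem s * K) := by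
  have hmul : ∀ x y : Q, idem s * x * (idem s * y) = idem s * (x * y) := fun x y => by
    rw [mul_assoc, ← mul_assoc x, ← idem_mul_comm, mul_assoc, ← mul_assoc, idem_mul_self hs]
  have hl : ∀ x : Q, idem s * (idem s * x) = idem s * x := fun x => by
    rw [← mul_assoc, idem_mul_self hs]
  have hr : ∀ x : Q, idem s * x * idem s = idem s * x := fun x => by
    rw [mul_assoc, ← idem_mul_comm, hl]
  refine ⟨idem_mul_self hs, hl _, hr _, hl _, hr _, hl _, hr _, ?_, ?_, ?_, ?_, ?_, ?_⟩
  · rw [hmul, ← pow_two, idem_mul_K_sq hs]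
  · rw [hmul, hmul, K_mul_E, mul_neg]
  · rw [hmul, hmul, K_mul_F, mul_neg]
  · have ht' : t = (2 * Complex.I)⁻¹ * (s - 1) := by
      rw [← ht, ← mul_assoc, inv_mul_cancel₀ (by simp), one_mul]
    rw [hmul, hmul, F_mul_E, mul_sub, mul_smul_comm, mul_sub, idem_mul_Kinv hs, ht']
    module
  · rw [hmul, E_mul_E, mul_zero]
  · rw [hmul, F_mul_F, mul_zero]

/-- The generators `E`, `F`, `K`, indexed by `Fin 3`. -/
def generator : Fin 3 → Q := ![E, F, K]

/-- In the corner of `idem s ⊗ idem s'`, the comultiplication and its opposite are conjugate. -/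
def CornerCocommutative (s s' : ℂ) : Prop :=
  ∃ r r' : Q ⊗[ℂ] Q, r * r' = idem s ⊗ₜ idem s' ∧ r' * r = idem s ⊗ₜ idem s' ∧
    ∀ i, r * (idem s ⊗ₜ idem s' * comulHom (generator i)) =
      idem s ⊗ₜ idem s' * TensorProduct.comm ℂ Q Q (comulHom (generator i)) * r

lemma cornerCocommutative_of_semiconjBy {s s' : ℂ} (hs : s * s = 1) (hs' : s' * s' = 1)
    {r r' : Q ⊗[ℂ] Q} (hr : IsCornerInverse (idem s ⊗ₜ idem s') r r')
    (hE : SemiconjBy r (idem s ⊗ₜ (idem s' * E) + (idem s * E) ⊗ₜ (idem s' * K))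
      ((idem s * E) ⊗ₜ idem s' + (idem s * K) ⊗ₜ (idem s' * E)))
    (hF : SemiconjBy r (s • (idem s * K) ⊗ₜ (idem s' * F) + (idem s * F) ⊗ₜ idem s')
      (s' • (idem s * F) ⊗ₜ (idem s' * K) + idem s ⊗ₜ (idem s' * F)))
    (hK : SemiconjBy r ((idem s * K) ⊗ₜ (idem s' * K)) ((idem s * K) ⊗ₜ (idem s' * K))) :
    CornerCocommutative s s' := by
  refine ⟨r, r', hr.mul, hr.mul', fun i => ?_⟩
  fin_cases i
  · simpa [generator, mul_add, add_comm] using hE.eq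
  · simpa [generator, mul_add, add_comm, idem_mul_Kinv hs, idem_mul_Kinv hs',
      ← TensorProduct.smul_tmul'] using hF.eq
  · simpa [generator] using hK.eq

/-- The inverse `r'` intertwines `Δᵒᵖ` with `Δ`; applying the flip exchanges them again and swaps
the two idempotents. -/
lemma CornerCocommutative.symm {s s' : ℂ} (hs : s * s = 1) (hs' : s' * s' = 1)
    (h : CornerCocommutative s s') : CornerCocommutative s' s := by
  obtain ⟨r, r', h₁, h₂, h₃⟩ := h
  have hcomm : ∀ x y : Q ⊗[ℂ] Q, TensorProduct.comm ℂ Q Q (x * y) =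
      TensorProduct.comm ℂ Q Q x * TensorProduct.comm ℂ Q Q y :=
    map_mul (Algebra.TensorProduct.comm ℂ Q Q)
  have hεε : (idem s ⊗ₜ[ℂ] idem s' : Q ⊗[ℂ] Q) * idem s ⊗ₜ idem s' = idem s ⊗ₜ idem s' := by
    rw [Algebra.TensorProduct.tmul_mul_tmul, idem_mul_self hs, idem_mul_self hs']
  have hε : ∀ x : Q ⊗[ℂ] Q, idem s ⊗ₜ idem s' * x = x * idem s ⊗ₜ idem s' := by
    intro x
    induction x with
    | zero => simp
    | add x y hx hy => rw [mul_add, add_mul, hx, hy]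
    | tmul a b => simp [idem_mul_comm]
  refine ⟨TensorProduct.comm ℂ Q Q r', TensorProduct.comm ℂ Q Q r, ?_, ?_, fun i => ?_⟩
  · rw [← hcomm, h₂, TensorProduct.comm_tmul]
  · rw [← hcomm, h₁, TensorProduct.comm_tmul]
  · have h : r' * (idem s ⊗ₜ idem s' * TensorProduct.comm ℂ Q Q (comulHom (generator i))) =
        idem s ⊗ₜ idem s' * comulHom (generator i) * r' := by
      have h' := congrArg (fun z => r' * z * r') (h₃ i)
      simp only [← mul_assoc, h₂] at h'
      simp only [mul_assoc, h₁] at h'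
      simp only [← mul_assoc, hεε] at h'
      rw [h', mul_assoc (r' * _), ← hε (TensorProduct.comm ℂ Q Q _), ← mul_assoc (r' * _),
        mul_assoc r', hεε, mul_assoc]
    have h' := congrArg (TensorProduct.comm ℂ Q Q) h
    simpa only [hcomm, TensorProduct.comm_tmul, TensorProduct.comm_comm] using h'

lemma cornerCocommutative (i j : Fin 2) :
    CornerCocommutative ((-1) ^ (i : ℕ)) ((-1) ^ (j : ℕ)) := by
  have h1 : (1 : ℂ) * 1 = 1 := one_mul 1
  have h2 : (-1 : ℂ) * -1 = 1 := by norm_num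
  have he := cornerRel (s := 1) (t := 0) h1 (by simp)
  have ho := cornerRel (s := -1) (t := Complex.I) h2
    (by rw [mul_assoc, Complex.I_mul_I]; norm_num)
  have heo : CornerCocommutative 1 (-1) := by
    obtain ⟨r, r', h, hE, hF, hK⟩ := exists_intertwiner_even_odd he ho
    exact cornerCocommutative_of_semiconjBy h1 h2 h hE (by simpa using hF) hK
  fin_cases i <;> fin_cases j <;> simp only [pow_zero, pow_one]
  · obtain ⟨r, r', h, hE, hF, hK⟩ := exists_intertwiner_even_even he
    exact cornerCocommutative_of_semiconjBy h1 h1 h hE (by simpa using hF) hK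
  · exact heo
  · exact heo.symm h1 h2
  · obtain ⟨r, r', h, hE, hF, hK⟩ := exists_intertwiner_odd_odd ho
    exact cornerCocommutative_of_semiconjBy h2 h2 h hE (by simpa using hF) hK

lemma exists_cocommutator : ∃ R : (Q ⊗[ℂ] Q)ˣ, ∀ a : Q,
    (R : Q ⊗[ℂ] Q) * comulHom a = TensorProduct.comm ℂ Q Q (comulHom a) * R := by
  have hs : ∀ i : Fin 2, ((-1 : ℂ) ^ (i : ℕ)) * (-1) ^ (i : ℕ) = 1 := fun i => by
    rw [← mul_pow]; simp
  have horth : ∀ i j : Fin 2, idem ((-1) ^ (i : ℕ)) * idem ((-1) ^ (j : ℕ)) =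
      if i = j then idem ((-1) ^ (i : ℕ)) else 0 := by
    intro i j
    split_ifs with hij
    · rw [← hij, idem_mul_self (hs i)]
    · rw [idem_mul_idem]
      fin_cases i <;> fin_cases j <;> simp at hij ⊢
  have hsum : idem 1 + idem (-1) = 1 := by
    simp only [idem]
    module
  obtain ⟨R, hR⟩ := exists_unit_intertwining_of_corners
    (fun i : Fin 2 × Fin 2 => (idem ((-1) ^ (i.1 : ℕ)) ⊗ₜ[ℂ] idem ((-1) ^ (i.2 : ℕ)) : Q ⊗[ℂ] Q))
    (by
      rw [Fintype.sum_prod_type]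
      simp only [Fin.sum_univ_two, Fin.val_zero, Fin.val_one, pow_zero, pow_one]
      rw [← TensorProduct.tmul_add, ← TensorProduct.tmul_add, ← TensorProduct.add_tmul, hsum]
      rfl)
    (by
      rintro ⟨i, j⟩ ⟨i', j'⟩
      simp only [Algebra.TensorProduct.tmul_mul_tmul, horth, Prod.mk.injEq]
      split_ifs <;> simp_all)
    (by
      intro i x
      induction x with
      | zero => simp
      | add x y hx hy => rw [mul_add, add_mul, hx, hy]
      | tmul a b => simp [idem_mul_comm])
    (fun i => comulHom (generator i))
    (fun i => TensorProduct.comm ℂ Q Q (comulHom (generator i)))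
    (fun i => cornerCocommutative i.1 i.2)
  -- The intertwining relation is multiplicative in `a`, so the generators suffice, `K⁻¹` being `K ^
  -- 3`.
  have hmul : ∀ a b : Q,
      (R : Q ⊗[ℂ] Q) * comulHom a = TensorProduct.comm ℂ Q Q (comulHom a) * R →
      (R : Q ⊗[ℂ] Q) * comulHom b = TensorProduct.comm ℂ Q Q (comulHom b) * R →
      (R : Q ⊗[ℂ] Q) * comulHom (a * b) = TensorProduct.comm ℂ Q Q (comulHom (a * b)) * R := by
    intro a b ha hb
    have h : TensorProduct.comm ℂ Q Q (comulHom a * comulHom b) =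
        TensorProduct.comm ℂ Q Q (comulHom a) * TensorProduct.comm ℂ Q Q (comulHom b) :=
      map_mul (Algebra.TensorProduct.comm ℂ Q Q) _ _
    rw [map_mul, h, ← mul_assoc, ha, mul_assoc, hb, mul_assoc]
  refine ⟨R, fun a => ?_⟩
  induction a using induction_gen with
  | hc c =>
    have h : TensorProduct.comm ℂ Q Q (1 : Q ⊗[ℂ] Q) = 1 := rfl
    simp [Algebra.algebraMap_eq_smul_one, h]
  | hE => exact hR 0
  | hF => exact hR 1
  | hK => exact hR 2
  | hKinv =>
    rw [Kinv_eq, pow_succ, pow_two]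
    exact hmul _ _ (hmul _ _ (hR 2) (hR 2)) (hR 2)
  | hadd a b ha hb => simp only [map_add, mul_add, add_mul, ha, hb]
  | hmul a b ha hb => exact hmul a b ha hb

end Q

end RestrictedQuantumGroup

theorem theorem1 :
    Module.finrank ℂ RestrictedQuantumGroup.Q = 16 ∧
    IsEmpty (BraidedCategory (FinDimRep ℂ RestrictedQuantumGroup.Q)) ∧
    (¬ ∃ R : RestrictedQuantumGroup.Q ⊗[ℂ] RestrictedQuantumGroup.Q, IsUniversalRMatrix ℂ R) ∧
    ∀ U V : FinDimRep ℂ RestrictedQuantumGroup.Q, Nonempty (U ⊗ V ≅ V ⊗ U) := by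
  obtain ⟨R, hR⟩ := RestrictedQuantumGroup.Q.exists_cocommutator
  exact ⟨RestrictedQuantumGroup.Q.finrank_eq, RestrictedQuantumGroup.Q.isEmpty_braidedCategory,
    RestrictedQuantumGroup.Q.not_exists_isUniversalRMatrix, FinDimRep.nonempty_tensor_comm R hR⟩
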